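/- Let $0<c\le 1$ and let $H$ be a probability measure on $[0,\infty)^2$ (coordinates $(s,t)$) with $\int t\,\mathrm dH(s,t)<\infty$ and $\int t^{-1}\,\mathrm dH(s,t)<\infty$. Write $\mathbb C^+=\{z\in\mathbb C:\Im z>0\}$ and, for a finite measure $\mu$ on $\mathbb R$, $m_\mu(z)=\int(\lambda-z)^{-1}\,\mathrm d\mu(\lambda)$. Let $F$ be the limiting spectral distribution (LSD) determined by $(c,H)$, that is, a probability distribution on $[0,\infty)$ for which there is a function $g$ with $g(z)\in\mathbb C^+$ such that, for every $z\in\mathbb C^+$, the pair $m=m_F(z)$, $g=g(z)$ satisfies $$m=\int\frac{\mathrm dH(s,t)}{\frac{s}{1+cg}-(1+cmt)z+t(1-c)},\qquad g=\int\frac{t\,\mathrm dH(s,t)}{\frac{s}{1+cg}-(1+cmt)z+t(1-c)}.$$ Let $\underline F=(1-c)\delta_0+cF$ be the companion distribution, so that $m_{\underline F}(z)=-\frac{1-c}{z}+c\,m_F(z)$, and let $\underline g(z)=-\frac{1}{z(1+cg(z))}$. Then: 1. For every real $x\neq0$ the limits $\underline m(x)=\lim_{z\in\mathbb C^+,\,z\to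 x}m_{\underline F}(z)$ and $\underline g(x)=\lim_{z\in\mathbb C^+,\,z\to x}\underline g(z)$ exist in $\mathbb C$, $\underline g(x)\ne0$, $1+s\underline g(x)+t\underline m(x)\neq0$ for $H$-almost every $(s,t)$, and $(x,\underline m(x),\underline g(x))$ satisfies, with absolutely convergent integrals, $$x\,\underline m(x)=-(1-c)-c\int\frac{\mathrm dH(s,t)}{1+s\underline g(x)+t\underline m(x)},\qquad x=-\frac1{\underline g(x)}+c\int\frac{t\,\mathrm dH(s,t)}{1+s\underline g(x)+t\underline m(x)}.$$ 2. The function $\underline m$ is continuous on $\mathbb R\setminus\{0\}$. 3. Put $f(x)=\frac1\pi\Im\underline m(x)$ for $x\ne0$. The distribution function $x\mapsto\underline F((-\infty,x])$ is differentiable at every $x\ne0$ with derivative $f(x)$, which is thus continuous on $\mathbb R\setminus\{0\}$, and on $\mathbb R\setminus\{0\}$ the measure $\underline F$ has density $f$ with respect to Lebesgue measure. Equivalently, $x\mapsto F((-\infty,x])$ has derivative $f(x)/c$ at every $x\neq0$. 4. If $x\ne0$ and $\Im\underline m(x)>0$ (that is, $f(x)>0$), then $f$ is real-analytic in a neighbourhood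 of $x$. -/

import Mathlib

open MeasureTheory Filter Topology Set

noncomputable section

/-- The Stieltjes transform `m_μ(z) = ∫ 1 / (l - z) dμ(l)` of a measure on the real line. -/
def stieltjes (μ : Measure ℝ) (z : ℂ) : ℂ := ∫ l : ℝ, ((l : ℂ) - z)⁻¹ ∂μ

/-- The open upper half plane `ℂ⁺`. -/
def upperHalf : Set ℂ := {z : ℂ | 0 < z.im}

/-- The common denominator `s / (1 + c g) - (1 + c m t) z + t (1 - c)` of the integrands in the
system that determines the limiting spectral distribution; `p = (s, t)`. -/
def lsdDenom (c : ℝ) (z m g : ℂ) (p : ℝ × ℝ) : ℂ :=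
  (p.1 : ℂ) / (1 + (c : ℂ) * g) - (1 + (c : ℂ) * m * (p.2 : ℂ)) * z
    + (p.2 : ℂ) * (1 - (c : ℂ))

/-- The pair `(m, g)` solves, at the point `z`, the system
`m = ∫ dH(s,t) / (s / (1 + c g) - (1 + c m t) z + t (1 - c))`,
`g = ∫ t dH(s,t) / (s / (1 + c g) - (1 + c m t) z + t (1 - c))`. -/
structure SolvesLSDSystem (c : ℝ) (H : Measure (ℝ × ℝ)) (z m g : ℂ) : Prop where
  integrable_fst : Integrable (fun p : ℝ × ℝ => 1 / lsdDenom c z m g p) H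
  integrable_snd : Integrable (fun p : ℝ × ℝ => (p.2 : ℂ) / lsdDenom c z m g p) H
  eq_fst : m = ∫ p : ℝ × ℝ, 1 / lsdDenom c z m g p ∂H
  eq_snd : g = ∫ p : ℝ × ℝ, (p.2 : ℂ) / lsdDenom c z m g p ∂H

/-- `F` is the limiting spectral distribution determined by the limiting ratio `c` and the
limiting joint distribution `H`, with auxiliary function `g`: `F` is a probability distribution
on `[0, ∞)` and, at every `z ∈ ℂ⁺`, its Stieltjes transform `m_F(z)` and `g(z) ∈ ℂ⁺` solve the
system above. -/
structure IsLSD (c : ℝ) (H : Measure (ℝ × ℝ)) (F : Measure ℝ) (g : ℂ → ℂ) : Prop where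
  isProbabilityMeasure : IsProbabilityMeasure F
  nonneg : F (Iio 0) = 0
  im_pos : ∀ z ∈ upperHalf, 0 < (g z).im
  solves : ∀ z ∈ upperHalf, SolvesLSDSystem c H z (stieltjes F z) (g z)

/-- The companion distribution `(1 - c) δ₀ + c F` (for `0 ≤ c ≤ 1`). -/
def companionLSD (c : ℝ) (F : Measure ℝ) : Measure ℝ :=
  ENNReal.ofReal (1 - c) • Measure.dirac 0 + ENNReal.ofReal c • F

/-- The transformed auxiliary function `-1 / (z (1 + c g(z)))`. -/
def companionAux (c : ℝ) (g : ℂ → ℂ) (z : ℂ) : ℂ := -1 / (z * (1 + (c : ℂ) * g z))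

/-- `(m, g)`, with `g ≠ 0`, solves at `z` the transformed system
`z = - (1 - c) / m - (c / m) ∫ dH(s,t) / (1 + s g + t m)`,
`z = - 1 / g + c ∫ t dH(s,t) / (1 + s g + t m)`,
where the first equation is multiplied by `m`, so that it has a meaning also for `m = 0`. -/
structure SolvesCompanionSystem (c : ℝ) (H : Measure (ℝ × ℝ)) (z m g : ℂ) : Prop where
  denom_ne : ∀ᵐ p ∂H, 1 + (p.1 : ℂ) * g + (p.2 : ℂ) * m ≠ 0
  integrable_fst : Integrable (fun p : ℝ × ℝ => 1 / (1 + (p.1 : ℂ) * g + (p.2 : ℂ) * m)) H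
  integrable_snd :
    Integrable (fun p : ℝ × ℝ => (p.2 : ℂ) / (1 + (p.1 : ℂ) * g + (p.2 : ℂ) * m)) H
  aux_ne : g ≠ 0
  eq_fst : z * m =
    -(1 - (c : ℂ)) - (c : ℂ) * ∫ p : ℝ × ℝ, 1 / (1 + (p.1 : ℂ) * g + (p.2 : ℂ) * m) ∂H
  eq_snd : z =
    -1 / g + (c : ℂ) * ∫ p : ℝ × ℝ, (p.2 : ℂ) / (1 + (p.1 : ℂ) * g + (p.2 : ℂ) * m) ∂H

end

/-! Write `E = 1 + s g + t m` for the denominator at a companion solution. Over the upper half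
plane, the imaginary parts of the two equations, and of the same equations divided by `z`, are
linear relations between positive quantities. A Perron-Frobenius argument turns them into the
inequalities `IsStableSol`: the nonnegative 2×2 matrix of the moments `c ∫ k / |E|²`, `k = s, t, st,
t²`, is dominated by the diagonal matrix with entries `|z|` and `1 / |g|²`. The imaginary part of
`z` has disappeared from this statement, so it can survive on the real line; the slacks `β` and `r`
are there because Fatou only gives inequalities in the limit.

The moment `c ∫ t / |E|² ≤ |z|` controls everything else. As `|1/E|² = t⁻¹ · t/|E|²` and `|t/E|² = t
· t/|E|²`, integrability of `t` and of `t⁻¹` gives bounds on `m` and `1/g` (`companion_bounds`) and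
lets the integrals pass to the limit (`limit_equations`). Hence every cluster point of `(m, 1/g)` at
a real `x ≠ 0` solves the system and is stable (`limit_stable`); `1/g → 0` is impossible
(`not_tendsto_inv_zero`).

Uniqueness of the cluster point is `stable_pair_kernel`. The difference of two solutions lies in the
kernel of a 2×2 matrix with entries built from `∫ k / (E E')`. Cauchy-Schwarz and the two stability
inequalities leave a nonzero kernel, for `x > 0`, only in the equality case `E = conj E'`. Since
both imaginary parts are nonnegative, this forces `E = E'`. For `x < 0` the Stieltjes transform is
continuous at `x` and only `g` has to be identified. A compactness argument then gives the boundary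
limits (`IsLSD.exists_boundary_limit`).

Limits from the whole half plane at every point give a continuous boundary function, and Stieltjes
inversion turns it into the density. Where `Im m > 0`, the same kernel lemma, applied to a solution
paired with itself, shows that the derivative of the system is injective, because `E = conj E`
contradicts `Im E > 0`. The holomorphic inverse function theorem then makes the solution analytic in
`x`. -/

/-! ### Convergence of integrals and the Cauchy-Schwarz inequality -/

/-- A Vitali-type theorem: if `‖f n‖ ^ 2 ≤ w * q n` with `w` integrable and `∫ q n` bounded, then
almost everywhere convergence of `f n` implies convergence of the integrals. -/
theorem tendsto_integral_of_sq_le {α : Type*} [MeasurableSpace α] {μ : Measure α}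
    {f : ℕ → α → ℂ} {f₀ : α → ℂ} {w : α → ℝ} {q : ℕ → α → ℝ} {C : ℝ}
    (hf : ∀ n, AEStronglyMeasurable (f n) μ) (hw : Integrable w μ) (hw0 : ∀ᵐ a ∂μ, 0 ≤ w a)
    (hq : ∀ n, Integrable (q n) μ) (hq0 : ∀ n, ∀ᵐ a ∂μ, 0 ≤ q n a) (hC : ∀ n, ∫ a, q n a ∂μ ≤ C)
    (hle : ∀ n, ∀ᵐ a ∂μ, ‖f n a‖ ^ 2 ≤ w a * q n a)
    (hlim : ∀ᵐ a ∂μ, Tendsto (fun n => f n a) atTop (𝓝 (f₀ a))) :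
    Integrable f₀ μ ∧ Tendsto (fun n => ∫ a, f n a ∂μ) atTop (𝓝 (∫ a, f₀ a ∂μ)) := by
  have hC0 : 0 ≤ C := (integral_nonneg_of_ae (hq0 0)).trans (hC 0)
  have hbd : ∀ n, ∀ᵐ a ∂μ, ‖f n a‖ ≤ w a + q n a := by
    intro n
    filter_upwards [hle n, hw0, hq0 n] with a h1 h2 h3
    exact abs_le_of_sq_le_sq' (by nlinarith) (by positivity) |>.2
  have hfi : ∀ n, Integrable (f n) μ := fun n => (hw.add (hq n)).mono' (hf n) (hbd n)
  have hf0m : AEStronglyMeasurable f₀ μ := aestronglyMeasurable_of_tendsto_ae atTop hf hlim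
  have hf0 : Integrable f₀ μ := by
    refine ⟨hf0m, ?_⟩
    rw [HasFiniteIntegral]
    have hle' : ∀ n, ∫⁻ a, ‖f n a‖ₑ ∂μ ≤ ENNReal.ofReal (∫ a, w a ∂μ + C) := by
      intro n
      rw [← ofReal_integral_norm_eq_lintegral_enorm (hfi n)]
      apply ENNReal.ofReal_le_ofReal
      calc ∫ a, ‖f n a‖ ∂μ ≤ ∫ a, (w a + q n a) ∂μ :=
            integral_mono_ae (hfi n).norm (hw.add (hq n)) (hbd n)
        _ = ∫ a, w a ∂μ + ∫ a, q n a ∂μ := integral_add hw (hq n)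
        _ ≤ _ := by linarith [hC n]
    calc ∫⁻ a, ‖f₀ a‖ₑ ∂μ = ∫⁻ a, liminf (fun n => ‖f n a‖ₑ) atTop ∂μ := by
          refine lintegral_congr_ae ?_
          filter_upwards [hlim] with a ha
          exact (ha.enorm.liminf_eq).symm
      _ ≤ liminf (fun n => ∫⁻ a, ‖f n a‖ₑ ∂μ) atTop :=
          lintegral_liminf_le' fun n => (hf n).enorm
      _ ≤ ENNReal.ofReal (∫ a, w a ∂μ + C) :=
          liminf_le_of_frequently_le' (Frequently.of_forall hle')
      _ < ⊤ := ENNReal.ofReal_lt_top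
  refine ⟨hf0, ?_⟩
  rw [Metric.tendsto_atTop]
  intro e he
  set ε : ℝ := e / (2 * (C + 1)) with hε
  have hε0 : 0 < ε := by positivity
  -- Split at `‖f n‖ = w / ε`. Below this level `ψ n` is the full difference, dominated by a fixed
  -- integrable function; above it `‖f n‖ ^ 2 ≤ w * q n` forces `‖f n‖ ≤ ε * q n`, whose integral is
  -- at most `ε * C ≤ e / 2`.
  set ψ : ℕ → α → ℝ := fun n a => min ‖f n a - f₀ a‖ (w a / ε + ‖f₀ a‖) with hψ
  have hψm : ∀ n, AEStronglyMeasurable (ψ n) μ := fun n =>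
    (((hf n).sub hf0m).norm).inf ((hw.div_const ε).aestronglyMeasurable.add hf0m.norm)
  have hψb : ∀ n, ∀ᵐ a ∂μ, ‖ψ n a‖ ≤ w a / ε + ‖f₀ a‖ := by
    intro n
    filter_upwards [hw0] with a ha
    rw [Real.norm_of_nonneg (le_min (norm_nonneg _) (by positivity))]
    exact min_le_right _ _
  have hdom : Integrable (fun a => w a / ε + ‖f₀ a‖) μ := (hw.div_const ε).add hf0.norm
  have hψ0 : Tendsto (fun n => ∫ a, ψ n a ∂μ) atTop (𝓝 0) := by
    have := tendsto_integral_of_dominated_convergence (F := ψ) (f := fun _ => (0 : ℝ)) _ hψm hdom hψb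
      (by
        filter_upwards [hlim, hw0] with a ha hwa
        have h1 : Tendsto (fun n => ‖f n a - f₀ a‖) atTop (𝓝 0) :=
          tendsto_iff_norm_sub_tendsto_zero.1 ha
        refine squeeze_zero (fun n => le_min (norm_nonneg _) (by positivity))
          (fun n => min_le_left _ _) h1)
    simpa using this
  obtain ⟨N, hN⟩ := Metric.tendsto_atTop.1 hψ0 (e / 2) (by positivity)
  refine ⟨N, fun n hn => ?_⟩
  have h1 := hN n hn
  rw [Real.dist_eq, sub_zero] at h1
  rw [dist_eq_norm, ← integral_sub (hfi n) hf0]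
  have hψi : Integrable (ψ n) μ := hdom.mono' (hψm n) (hψb n)
  calc ‖∫ a, (f n a - f₀ a) ∂μ‖ ≤ ∫ a, ‖f n a - f₀ a‖ ∂μ := norm_integral_le_integral_norm _
    _ ≤ ∫ a, (ε * q n a + ψ n a) ∂μ := by
        refine integral_mono_ae ((hfi n).sub hf0).norm (((hq n).const_mul ε).add hψi) ?_
        filter_upwards [hle n, hw0, hq0 n] with a h1 h2 h3
        have h4 : ‖f n a - f₀ a‖ ≤ ‖f n a‖ + ‖f₀ a‖ := norm_sub_le _ _
        simp only [hψ]
        rcases le_total ‖f n a‖ (w a / ε) with h | h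
        · rw [min_eq_left (by linarith)]
          have : 0 ≤ ε * q n a := by positivity
          linarith
        · have h5 : ‖f n a‖ ≤ ε * q n a := by
            rw [div_le_iff₀ hε0] at h
            by_contra hcon
            push Not at hcon
            have h6 : 0 ≤ ε * q n a := by positivity
            have h7 : 0 < ‖f n a‖ := lt_of_le_of_lt h6 hcon
            have h8 : w a * q n a ≤ ‖f n a‖ * ε * q n a := by gcongr
            nlinarith
          have h9 : 0 ≤ w a / ε := by positivity
          have : 0 ≤ ε * q n a := by positivity
          rcases min_choice ‖f n a - f₀ a‖ (w a / ε + ‖f₀ a‖) with h' | h' <;> rw [h'] <;> linarith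
    _ = ε * ∫ a, q n a ∂μ + ∫ a, ψ n a ∂μ := by
        rw [integral_add ((hq n).const_mul ε) hψi, integral_const_mul]
    _ ≤ ε * C + ∫ a, ψ n a ∂μ := by gcongr; exact hC n
    _ < e / 2 + e / 2 := by
        have h2 : ε * C ≤ e / 2 := by
          rw [hε, div_mul_eq_mul_div, div_le_div_iff₀ (by positivity) (by norm_num)]
          nlinarith
        have := (le_abs_self _).trans_lt h1
        linarith
    _ = e := by ring

/-- The Cauchy-Schwarz inequality for `∫ φ` when `φ ^ 2 ≤ a * b`. -/
theorem sq_integral_le_of_sq_le_mul {α : Type*} [MeasurableSpace α] {μ : Measure α}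
    {φ a b : α → ℝ} (hφ : Integrable φ μ) (ha : Integrable a μ) (hb : Integrable b μ)
    (ha0 : ∀ᵐ x ∂μ, 0 ≤ a x) (hb0 : ∀ᵐ x ∂μ, 0 ≤ b x) (h : ∀ᵐ x ∂μ, φ x ^ 2 ≤ a x * b x) :
    (∫ x, φ x ∂μ) ^ 2 ≤ (∫ x, a x ∂μ) * ∫ x, b x ∂μ := by
  have key : ∀ y : ℝ, 0 ≤ (∫ x, a x ∂μ) * (y * y) + (-2 * ∫ x, φ x ∂μ) * y + ∫ x, b x ∂μ := by
    intro y
    have : (∫ x, a x ∂μ) * (y * y) + (-2 * ∫ x, φ x ∂μ) * y + ∫ x, b x ∂μ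
        = ∫ x, (a x * (y * y) + φ x * (-2 * y) + b x) ∂μ := by
      have h1 : ∫ x, (a x * (y * y) + φ x * (-2 * y) + b x) ∂μ
          = ∫ x, (a x * (y * y) + φ x * (-2 * y)) ∂μ + ∫ x, b x ∂μ :=
        integral_add ((ha.mul_const _).add (hφ.mul_const _)) hb
      rw [h1, integral_add (ha.mul_const _) (hφ.mul_const _), integral_mul_const,
        integral_mul_const]
      ring
    rw [this]
    refine integral_nonneg_of_ae ?_
    filter_upwards [ha0, hb0, h] with x h1 h2 h3
    show 0 ≤ a x * (y * y) + φ x * (-2 * y) + b x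
    rcases h1.eq_or_lt with h0 | h0
    · rw [← h0] at h3 ⊢
      have : φ x = 0 := by nlinarith
      rw [this]; linarith
    · have : 0 ≤ a x * (a x * (y * y) + φ x * (-2 * y) + b x) := by
        nlinarith [sq_nonneg (a x * y - φ x)]
      exact nonneg_of_mul_nonneg_right this h0
  have := discrim_le_zero key
  rw [discrim] at this
  nlinarith

/-! ### Stability inequalities in the upper half plane -/

/-- The denominator `1 + s g + t m` of the companion system. -/
noncomputable def den (m g : ℂ) (p : ℝ × ℝ) : ℂ := 1 + (p.1 : ℂ) * g + (p.2 : ℂ) * m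

theorem measurable_den (m g : ℂ) : Measurable (den m g) := by
  unfold den; fun_prop

theorem den_im (m g : ℂ) (p : ℝ × ℝ) : (den m g p).im = p.1 * g.im + p.2 * m.im := by
  simp [den]

theorem mul_den_im (z m g : ℂ) (p : ℝ × ℝ) :
    (z * den m g p).im = z.im + p.1 * (z * g).im + p.2 * (z * m).im := by
  simp [den]; ring

/-- The weighted second moment `c ∫ k / |1 + s g + t m|² dH`. -/
noncomputable def quad (c : ℝ) (H : Measure (ℝ × ℝ)) (k : ℝ × ℝ → ℝ) (m g : ℂ) : ENNReal :=
  ∫⁻ p, ENNReal.ofReal (c * (k p / ‖den m g p‖ ^ 2)) ∂H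

/-- The quadratic inequalities satisfied by the solutions of the companion system which are
obtained from the upper half plane; `R` stands for `|z|`. -/
def IsStableSol (c : ℝ) (H : Measure (ℝ × ℝ)) (R : ℝ) (m g : ℂ) : Prop :=
  ∃ β r : ℝ, 0 < β ∧ 0 ≤ r ∧
    quad c H (fun p => p.1 * p.2) m g + ENNReal.ofReal β ≤ ENNReal.ofReal (1 / ‖g‖ ^ 2) ∧
    quad c H (fun p => p.2) m g + ENNReal.ofReal r ≤ ENNReal.ofReal R ∧
    quad c H (fun p => p.1) m g * quad c H (fun p => p.2 ^ 2) m g ≤ ENNReal.ofReal (β * r)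

theorem im_real_div (k : ℝ) (y : ℂ) : ((k : ℂ) / y).im = -(k * y.im / ‖y‖ ^ 2) := by
  rw [Complex.div_im, ← Complex.normSq_eq_norm_sq]
  simp

theorem im_inv_mul_integral {H : Measure (ℝ × ℝ)} {m g : ℂ} {k : ℝ × ℝ → ℝ} (z : ℂ)
    (hk : Integrable (fun p => (k p : ℂ) / den m g p) H) :
    (z⁻¹ * ∫ p, (k p : ℂ) / den m g p ∂H).im
      = -(∫ p, k p * (z * den m g p).im / ‖den m g p‖ ^ 2 ∂H) / ‖z‖ ^ 2 := by
  rw [← integral_const_mul]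
  have h1 := integral_im (hk.const_mul z⁻¹)
  simp only [RCLike.im_eq_complex_im] at h1
  rw [← h1, ← integral_neg, ← integral_div]
  refine integral_congr_ae (ae_of_all _ fun p => ?_)
  have : z⁻¹ * ((k p : ℂ) / den m g p) = (k p : ℂ) / (z * den m g p) := by
    rw [div_mul_eq_div_div_swap]; ring
  simp only [this, im_real_div]
  rw [norm_mul, mul_pow, neg_div, div_div, mul_comm (‖z‖ ^ 2)]

theorem quad_eq_ofReal {c : ℝ} (hc : 0 ≤ c) {H : Measure (ℝ × ℝ)} {k : ℝ × ℝ → ℝ} {m g : ℂ}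
    (hk0 : ∀ᵐ p ∂H, 0 ≤ k p) (hk : Integrable (fun p => k p / ‖den m g p‖ ^ 2) H) :
    quad c H k m g = ENNReal.ofReal (c * ∫ p, k p / ‖den m g p‖ ^ 2 ∂H) := by
  rw [quad, ← integral_const_mul, ofReal_integral_eq_lintegral_ofReal (hk.const_mul c)]
  filter_upwards [hk0] with p hp
  positivity

theorem integrable_div_norm_sq_of_bound {H : Measure (ℝ × ℝ)} [IsFiniteMeasure H]
    {k : ℝ × ℝ → ℝ} (hkm : Measurable k) {m g : ℂ} (C : ℝ)
    (h : ∀ᵐ p ∂H, |k p| ≤ C * ‖den m g p‖ ^ 2) :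
    Integrable (fun p => k p / ‖den m g p‖ ^ 2) H := by
  refine Integrable.of_bound ((hkm.div ((measurable_den m g).norm.pow_const 2)).aestronglyMeasurable)
    |C| ?_
  filter_upwards [h] with p hp
  rw [norm_div, norm_pow, norm_norm, Real.norm_eq_abs]
  rcases eq_or_ne (den m g p) 0 with h0 | h0
  · simp [h0]
  · rw [div_le_iff₀ (by positivity)]
    exact hp.trans (mul_le_mul_of_nonneg_right (le_abs_self C) (by positivity))

theorem integral_linear_comb₃ {α : Type*} [MeasurableSpace α] {μ : Measure α} {f₁ f₂ f₃ : α → ℝ}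
    (h₁ : Integrable f₁ μ) (h₂ : Integrable f₂ μ) (h₃ : Integrable f₃ μ) (x y z : ℝ) :
    ∫ a, (x * f₁ a + y * f₂ a + z * f₃ a) ∂μ
      = x * ∫ a, f₁ a ∂μ + y * ∫ a, f₂ a ∂μ + z * ∫ a, f₃ a ∂μ := by
  rw [← integral_const_mul, ← integral_const_mul, ← integral_const_mul]
  have h : ∫ a, (x * f₁ a + y * f₂ a + z * f₃ a) ∂μ
      = ∫ a, (x * f₁ a + y * f₂ a) ∂μ + ∫ a, z * f₃ a ∂μ :=
    integral_add ((h₁.const_mul x).add (h₂.const_mul y)) (h₃.const_mul z)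
  rw [h, integral_add (h₁.const_mul x) (h₂.const_mul y)]

/-- With `β` the defect in the `st` inequality, the four identities bound `Im m` by a multiple of
`Im (z m)` and conversely. Composing the two bounds cancels both unknowns and leaves the determinant
inequality between moments. -/
theorem isStableSol_of_upperHalf {c : ℝ} (hc0 : 0 < c) (hc1 : c ≤ 1) {H : Measure (ℝ × ℝ)}
    [IsProbabilityMeasure H] (hH : ∀ᵐ p ∂H, 0 ≤ p.1 ∧ 0 < p.2) {z m g : ℂ} (hz : 0 < z.im)
    (h : SolvesCompanionSystem c H z m g) (hm : 0 < m.im) (hzm : 0 ≤ (z * m).im)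
    (hzg : 0 < (z * g).im) :
    0 < g.im ∧ IsStableSol c H ‖z‖ m g := by
  obtain ⟨-, hi1, hi2, hg, hA, hB⟩ := h
  change Integrable (fun p : ℝ × ℝ => 1 / den m g p) H at hi1
  change Integrable (fun p : ℝ × ℝ => (p.2 : ℂ) / den m g p) H at hi2
  change z * m = -(1 - (c : ℂ)) - (c : ℂ) * ∫ p : ℝ × ℝ, 1 / den m g p ∂H at hA
  change z = -1 / g + (c : ℂ) * ∫ p : ℝ × ℝ, (p.2 : ℂ) / den m g p ∂H at hB
  have hz0 : z ≠ 0 := by rintro rfl; simp at hz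
  have hm0 : m ≠ 0 := by rintro rfl; simp at hm
  have hnz : 0 < ‖z‖ := norm_pos_iff.2 hz0
  have hnm : 0 < ‖m‖ := norm_pos_iff.2 hm0
  have hng : 0 < ‖g‖ := norm_pos_iff.2 hg
  set v := z.im with hv
  set a := (z * m).im with ha
  set b := (z * g).im with hb
  -- `Im (z E) = v + s b + t a` has nonnegative terms, so `|E|` dominates `1` and `s`. Since `a` may
  -- vanish, `t` is bounded through `t m = E - 1 - s g` instead. These bounds make all the second
  -- moments finite.
  set K₁ := ‖z‖ / v with hK₁
  set K₂ := ‖z‖ / b with hK₂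
  set K₃ := (1 + K₁ + ‖g‖ * K₂) / ‖m‖ with hK₃
  have hK₁0 : 0 < K₁ := by positivity
  have hK₂0 : 0 < K₂ := by positivity
  have hK₃0 : 0 < K₃ := by positivity
  have hbd : ∀ᵐ p ∂H, 0 ≤ p.1 ∧ 0 < p.2 ∧ 1 ≤ K₁ * ‖den m g p‖ ∧ p.1 ≤ K₂ * ‖den m g p‖ ∧
      p.2 ≤ K₃ * ‖den m g p‖ := by
    filter_upwards [hH] with p hp
    have h1 : v + p.1 * b + p.2 * a ≤ ‖z‖ * ‖den m g p‖ := by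
      rw [← norm_mul, hv, hb, ha, ← mul_den_im]
      exact (le_abs_self _).trans (Complex.abs_im_le_norm _)
    have h2 : 0 ≤ p.1 * b := mul_nonneg hp.1 hzg.le
    have h3 : 0 ≤ p.2 * a := mul_nonneg hp.2.le hzm
    have e1 : 1 ≤ K₁ * ‖den m g p‖ := by
      rw [hK₁, div_mul_eq_mul_div, le_div_iff₀ hz]; linarith
    have e2 : p.1 ≤ K₂ * ‖den m g p‖ := by
      rw [hK₂, div_mul_eq_mul_div, le_div_iff₀ hzg]; linarith
    refine ⟨hp.1, hp.2, e1, e2, ?_⟩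
    rw [hK₃, div_mul_eq_mul_div, le_div_iff₀ hnm]
    have h4 : (p.2 : ℂ) * m = den m g p - 1 - p.1 * g := by rw [den]; ring
    calc p.2 * ‖m‖ = ‖(p.2 : ℂ) * m‖ := by simp [abs_of_pos hp.2]
      _ ≤ ‖den m g p‖ + 1 + p.1 * ‖g‖ := by
          rw [h4]
          refine (norm_sub_le _ _).trans (add_le_add ((norm_sub_le _ _).trans (by simp)) ?_)
          simp [abs_of_nonneg hp.1]
      _ ≤ ‖den m g p‖ + K₁ * ‖den m g p‖ + (K₂ * ‖den m g p‖) * ‖g‖ := by gcongr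
      _ = _ := by ring
  have hH1 : ∀ᵐ p ∂H, 0 ≤ p.1 := hH.mono fun p hp => hp.1
  have hH2 : ∀ᵐ p ∂H, 0 ≤ p.2 := hH.mono fun p hp => hp.2.le
  have j1 : Integrable (fun p : ℝ × ℝ => (1 : ℝ) / ‖den m g p‖ ^ 2) H := by
    refine integrable_div_norm_sq_of_bound measurable_const (K₁ * K₁) (hbd.mono fun p hp => ?_)
    obtain ⟨h1, h2, e1, e2, e3⟩ := hp
    rw [abs_one]
    nlinarith
  have js : Integrable (fun p : ℝ × ℝ => p.1 / ‖den m g p‖ ^ 2) H := by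
    refine integrable_div_norm_sq_of_bound measurable_fst (K₂ * K₁) (hbd.mono fun p hp => ?_)
    obtain ⟨h1, h2, e1, e2, e3⟩ := hp
    rw [abs_of_nonneg h1]
    calc p.1 = p.1 * 1 := by ring
      _ ≤ (K₂ * ‖den m g p‖) * (K₁ * ‖den m g p‖) := by gcongr
      _ = _ := by ring
  have jt : Integrable (fun p : ℝ × ℝ => p.2 / ‖den m g p‖ ^ 2) H := by
    refine integrable_div_norm_sq_of_bound measurable_snd (K₃ * K₁) (hbd.mono fun p hp => ?_)
    obtain ⟨h1, h2, e1, e2, e3⟩ := hp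
    rw [abs_of_nonneg h2.le]
    calc p.2 = p.2 * 1 := by ring
      _ ≤ (K₃ * ‖den m g p‖) * (K₁ * ‖den m g p‖) := by gcongr
      _ = _ := by ring
  have jst : Integrable (fun p : ℝ × ℝ => p.1 * p.2 / ‖den m g p‖ ^ 2) H := by
    refine integrable_div_norm_sq_of_bound (measurable_fst.mul measurable_snd) (K₂ * K₃)
      (hbd.mono fun p hp => ?_)
    obtain ⟨h1, h2, e1, e2, e3⟩ := hp
    rw [Pi.mul_apply, abs_of_nonneg (mul_nonneg h1 h2.le)]
    calc p.1 * p.2 ≤ (K₂ * ‖den m g p‖) * (K₃ * ‖den m g p‖) := by gcongr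
      _ = _ := by ring
  have jtt : Integrable (fun p : ℝ × ℝ => p.2 ^ 2 / ‖den m g p‖ ^ 2) H := by
    refine integrable_div_norm_sq_of_bound (measurable_snd.pow_const 2) (K₃ * K₃)
      (hbd.mono fun p hp => ?_)
    obtain ⟨h1, h2, e1, e2, e3⟩ := hp
    rw [abs_of_nonneg (sq_nonneg _), pow_two]
    calc p.2 * p.2 ≤ (K₃ * ‖den m g p‖) * (K₃ * ‖den m g p‖) := by gcongr
      _ = _ := by ring
  set I₁ := ∫ p : ℝ × ℝ, (1 : ℝ) / ‖den m g p‖ ^ 2 ∂H with hI₁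
  set S := ∫ p : ℝ × ℝ, p.1 / ‖den m g p‖ ^ 2 ∂H with hS
  set T := ∫ p : ℝ × ℝ, p.2 / ‖den m g p‖ ^ 2 ∂H with hT
  set ST := ∫ p : ℝ × ℝ, p.1 * p.2 / ‖den m g p‖ ^ 2 ∂H with hST
  set TT := ∫ p : ℝ × ℝ, p.2 ^ 2 / ‖den m g p‖ ^ 2 ∂H with hTT
  have I₁0 : 0 ≤ I₁ := integral_nonneg fun p => by positivity
  have S0 : 0 ≤ S := integral_nonneg_of_ae (hH.mono fun p hp => by have := hp.1; positivity)
  have TT0 : 0 ≤ TT := integral_nonneg fun p => by positivity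
  have T0 : 0 < T := by
    rw [hT, integral_pos_iff_support_of_nonneg_ae
      (hH.mono fun p hp => by have := hp.2; positivity) jt]
    have : (Function.support fun p : ℝ × ℝ => p.2 / ‖den m g p‖ ^ 2) =ᵐ[H] univ := by
      rw [eventuallyEq_univ]
      filter_upwards [hbd] with p hp
      obtain ⟨h1, h2, e1, -, -⟩ := hp
      have : 0 < ‖den m g p‖ := by
        by_contra hcon
        have : ‖den m g p‖ = 0 := le_antisymm (not_lt.1 hcon) (norm_nonneg _)
        rw [this] at e1; norm_num at e1
      simp only [Function.mem_support]
      positivity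
    rw [measure_congr this]; simp
  have im1 : ∀ y : ℂ, (y⁻¹ * ∫ p, 1 / den m g p ∂H).im
      = -(y.im * I₁ + (y * g).im * S + (y * m).im * T) / ‖y‖ ^ 2 := by
    intro y
    have := im_inv_mul_integral (k := fun _ => 1) y (by simpa using hi1)
    simp only [Complex.ofReal_one] at this
    rw [this, hI₁, hS, hT, ← integral_linear_comb₃ j1 js jt]
    congr 2
    refine integral_congr_ae (ae_of_all _ fun p => ?_)
    simp only [mul_den_im]
    ring
  have im2 : ∀ y : ℂ, (y⁻¹ * ∫ p : ℝ × ℝ, (p.2 : ℂ) / den m g p ∂H).im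
      = -(y.im * T + (y * g).im * ST + (y * m).im * TT) / ‖y‖ ^ 2 := by
    intro y
    rw [im_inv_mul_integral (k := fun p => p.2) y hi2, hT, hST, hTT,
      ← integral_linear_comb₃ jt jst jtt]
    congr 2
    refine integral_congr_ae (ae_of_all _ fun p => ?_)
    simp only [mul_den_im]
    ring
  have ginv : (-1 / g).im = g.im / ‖g‖ ^ 2 := by
    have := im_real_div (-1) g
    push_cast at this
    rw [this]; ring
  have zginv : (-1 / (z * g)).im = b / (‖z‖ ^ 2 * ‖g‖ ^ 2) := by
    have := im_real_div (-1) (z * g)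
    push_cast at this
    rw [this, norm_mul, hb]; ring
  -- the four identities between imaginary parts
  have eq1 : v = g.im / ‖g‖ ^ 2 - c * (g.im * ST + m.im * TT) := by
    have h1 := im2 1
    simp only [inv_one, one_mul, Complex.one_im, zero_mul, zero_add, norm_one, one_pow,
      div_one] at h1
    have h2 := congrArg Complex.im hB
    rw [Complex.add_im, ginv, Complex.im_ofReal_mul, h1] at h2
    rw [hv]; linarith
  have eq2 : a = c * (g.im * S + m.im * T) := by
    have h1 := im1 1
    simp only [inv_one, one_mul, Complex.one_im, zero_mul, zero_add, norm_one, one_pow,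
      div_one] at h1
    have h2 := congrArg Complex.im hA
    rw [Complex.sub_im, Complex.im_ofReal_mul, h1] at h2
    simp at h2
    rw [ha]; simp; linarith
  have eq3 : b / ‖g‖ ^ 2 = c * (v * T + b * ST + a * TT) := by
    have h0 : (1 : ℂ) = -1 / (z * g) + c * (z⁻¹ * ∫ p : ℝ × ℝ, (p.2 : ℂ) / den m g p ∂H) := by
      calc (1 : ℂ) = z⁻¹ * z := by field_simp
        _ = z⁻¹ * (-1 / g + (c : ℂ) * ∫ p : ℝ × ℝ, (p.2 : ℂ) / den m g p ∂H) := by rw [← hB]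
        _ = _ := by field_simp
    have h2 := congrArg Complex.im h0
    rw [Complex.add_im, zginv, Complex.im_ofReal_mul, im2 z] at h2
    simp only [Complex.one_im] at h2
    field_simp at h2
    field_simp
    linarith
  have eq4 : ‖z‖ ^ 2 * m.im = (1 - c) * v + c * (v * I₁ + b * S + a * T) := by
    have h0 : m = ((-(1 - c) : ℝ) : ℂ) / z - c * (z⁻¹ * ∫ p : ℝ × ℝ, 1 / den m g p ∂H) := by
      calc m = z⁻¹ * (z * m) := by field_simp
        _ = z⁻¹ * (-(1 - (c : ℂ)) - (c : ℂ) * ∫ p : ℝ × ℝ, 1 / den m g p ∂H) := by rw [hA]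
        _ = _ := by push_cast; field_simp
    have h2 := congrArg Complex.im h0
    rw [Complex.sub_im, im_real_div, Complex.im_ofReal_mul, im1 z] at h2
    rw [h2]
    field_simp
    ring
  set β := 1 / ‖g‖ ^ 2 - c * ST with hβ
  have eq3' : b * β = c * (v * T + a * TT) := by
    rw [hβ, mul_sub, mul_one_div, eq3]; ring
  have hβ0 : 0 < β := by
    have : 0 < b * β := by rw [eq3']; positivity
    exact pos_of_mul_pos_right this hzg.le
  have eq1' : g.im * β = v + c * (m.im * TT) := by
    rw [hβ, mul_sub, mul_one_div]; linarith
  have hg1 : 0 < g.im := by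
    have : 0 < g.im * β := by rw [eq1']; positivity
    exact pos_of_mul_pos_left this hβ0.le
  refine ⟨hg1, β, ‖z‖ - c * T, hβ0, ?_⟩
  -- The claim `W ≤ β ‖z‖` is exactly the determinant inequality with `r = ‖z‖ - c T`. It follows
  -- from `in1` and `in2`, which say that `W` maps `Im m` below `β a` and `a` below `β ‖z‖² Im m`.
  set W := (c * S) * (c * TT) + c * T * β with hW
  have hW0 : 0 < W := by positivity
  have in1 : m.im * W ≤ β * a := by
    have : β * a = c * S * (g.im * β) + c * m.im * T * β := by rw [eq2]; ring
    rw [this, eq1', hW]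
    have : 0 ≤ c * S * v := by positivity
    linarith
  have in2 : a * W ≤ β * (‖z‖ ^ 2 * m.im) := by
    have : β * (‖z‖ ^ 2 * m.im) = β * ((1 - c) * v + c * v * I₁) + c * S * (b * β) + c * a * T * β := by
      rw [eq4]; ring
    rw [this, eq3', hW]
    have h1 : 0 ≤ β * ((1 - c) * v + c * v * I₁) := by
      have : 0 ≤ 1 - c := by linarith
      positivity
    have h2 : 0 ≤ c * S * (c * (v * T)) := by positivity
    linarith
  have in3 : W ≤ β * ‖z‖ := by
    have h1 : m.im * W ^ 2 ≤ m.im * (β * ‖z‖) ^ 2 := by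
      calc m.im * W ^ 2 = (m.im * W) * W := by ring
        _ ≤ (β * a) * W := by gcongr
        _ = β * (a * W) := by ring
        _ ≤ β * (β * (‖z‖ ^ 2 * m.im)) := by gcongr
        _ = _ := by ring
    exact (abs_le_of_sq_le_sq' (le_of_mul_le_mul_left h1 hm) (by positivity)).2
  have hr0 : 0 ≤ ‖z‖ - c * T := by
    have h1 : 0 ≤ (c * S) * (c * TT) := by positivity
    have : 0 ≤ β * (‖z‖ - c * T) := by rw [hW] at in3; linarith
    exact nonneg_of_mul_nonneg_right this hβ0
  have ST0 : 0 ≤ ST := integral_nonneg_of_ae (hH.mono fun p hp => by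
    have h1 := hp.1; have h2 := hp.2; positivity)
  refine ⟨hr0, ?_, ?_, ?_⟩
  · rw [quad_eq_ofReal hc0.le (hH.mono fun p hp => mul_nonneg hp.1 hp.2.le) jst,
      ← ENNReal.ofReal_add (by positivity) hβ0.le]
    apply ENNReal.ofReal_le_ofReal
    rw [hβ]; linarith
  · rw [quad_eq_ofReal hc0.le hH2 jt, ← ENNReal.ofReal_add (by positivity) hr0]
    apply ENNReal.ofReal_le_ofReal
    linarith
  · rw [quad_eq_ofReal hc0.le hH1 js, quad_eq_ofReal hc0.le (ae_of_all _ fun p => sq_nonneg _) jtt,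
      ← ENNReal.ofReal_mul (by positivity)]
    apply ENNReal.ofReal_le_ofReal
    rw [hW] at in3
    linarith

/-! ### Passage to the limit in the companion system -/

theorem integrable_of_quad_ne_top {c : ℝ} (hc : 0 < c) {H : Measure (ℝ × ℝ)} {k : ℝ × ℝ → ℝ}
    (hkm : Measurable k) (hk0 : ∀ᵐ p ∂H, 0 ≤ k p) {m g : ℂ} (h : quad c H k m g ≠ ⊤) :
    Integrable (fun p => k p / ‖den m g p‖ ^ 2) H := by
  have h1 : Integrable (fun p => c * (k p / ‖den m g p‖ ^ 2)) H := by
    have hm : AEStronglyMeasurable (fun p => c * (k p / ‖den m g p‖ ^ 2)) H :=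
      ((hkm.div ((measurable_den m g).norm.pow_const 2)).const_mul c).aestronglyMeasurable
    refine ⟨hm, ?_⟩
    rw [hasFiniteIntegral_iff_ofReal (hk0.mono fun p hp => by positivity)]
    exact h.lt_top
  have := h1.const_mul c⁻¹
  refine this.congr (ae_of_all _ fun p => ?_)
  simp only
  field_simp

theorem integral_le_of_quad_le {c : ℝ} (hc : 0 < c) {H : Measure (ℝ × ℝ)} {k : ℝ × ℝ → ℝ}
    (hkm : Measurable k) (hk0 : ∀ᵐ p ∂H, 0 ≤ k p) {m g : ℂ} {R : ℝ} (hR : 0 ≤ R)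
    (h : quad c H k m g ≤ ENNReal.ofReal R) :
    Integrable (fun p => k p / ‖den m g p‖ ^ 2) H ∧
      c * ∫ p, k p / ‖den m g p‖ ^ 2 ∂H ≤ R := by
  have h1 := integrable_of_quad_ne_top hc hkm hk0 (h.trans_lt ENNReal.ofReal_lt_top).ne
  refine ⟨h1, ?_⟩
  rw [quad_eq_ofReal hc.le hk0 h1] at h
  exact (ENNReal.ofReal_le_ofReal_iff hR).1 h

theorem quad_le_liminf {c : ℝ} {H : Measure (ℝ × ℝ)} {k : ℝ × ℝ → ℝ} (hkm : Measurable k)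
    {m g : ℕ → ℂ} {m₀ g₀ : ℂ} (hm : Tendsto m atTop (𝓝 m₀)) (hg : Tendsto g atTop (𝓝 g₀))
    (hne : ∀ᵐ p ∂H, den m₀ g₀ p ≠ 0) :
    quad c H k m₀ g₀ ≤ liminf (fun n => quad c H k (m n) (g n)) atTop := by
  refine le_trans (le_of_eq ?_) (lintegral_liminf_le fun n =>
    ((hkm.div ((measurable_den (m n) (g n)).norm.pow_const 2)).const_mul c).ennreal_ofReal)
  refine lintegral_congr_ae ?_
  filter_upwards [hne] with p hp
  have h1 : Tendsto (fun n => den (m n) (g n) p) atTop (𝓝 (den m₀ g₀ p)) :=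
    (tendsto_const_nhds.add (hg.const_mul _)).add (hm.const_mul _)
  have h2 : Tendsto (fun n => ENNReal.ofReal (c * (k p / ‖den (m n) (g n) p‖ ^ 2))) atTop
      (𝓝 (ENNReal.ofReal (c * (k p / ‖den m₀ g₀ p‖ ^ 2)))) :=
    ENNReal.tendsto_ofReal ((tendsto_const_nhds.div (h1.norm.pow 2)
      (pow_ne_zero 2 (norm_ne_zero_iff.2 hp))).const_mul c)
  exact h2.liminf_eq.symm

/-- If the moments `c ∫ t / |E n|² dH` are bounded then the denominators `E n` do not tend to `0`. -/
theorem ae_not_tendsto_den_zero {c : ℝ} (hc : 0 < c) {H : Measure (ℝ × ℝ)}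
    (hH : ∀ᵐ p ∂H, 0 ≤ p.1 ∧ 0 < p.2) {m g : ℕ → ℂ} {C : ℝ}
    (hne : ∀ n, ∀ᵐ p ∂H, den (m n) (g n) p ≠ 0)
    (hC : ∀ n, quad c H (fun p => p.2) (m n) (g n) ≤ ENNReal.ofReal C) :
    ∀ᵐ p ∂H, ¬ Tendsto (fun n => den (m n) (g n) p) atTop (𝓝 0) := by
  have hmeas : ∀ n, Measurable fun p : ℝ × ℝ =>
      ENNReal.ofReal (c * (p.2 / ‖den (m n) (g n) p‖ ^ 2)) := fun n =>
    ((measurable_snd.div ((measurable_den (m n) (g n)).norm.pow_const 2)).const_mul c).ennreal_ofReal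
  -- By Fatou the lower limit of `t / |E n|²` has finite integral, so it is finite almost
  -- everywhere; at a point where `E n → 0` it would be infinite.
  have h1 : ∫⁻ p, liminf (fun n => ENNReal.ofReal (c * (p.2 / ‖den (m n) (g n) p‖ ^ 2))) atTop ∂H
      ≠ ⊤ := by
    refine ((lintegral_liminf_le hmeas).trans
      (liminf_le_of_frequently_le' (Frequently.of_forall hC))).trans_lt ENNReal.ofReal_lt_top |>.ne
  filter_upwards [ae_lt_top (Measurable.liminf hmeas) h1, hH, ae_all_iff.2 hne] with p h2 hp h3 h4
  refine h2.ne ?_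
  refine Tendsto.liminf_eq (ENNReal.tendsto_ofReal_atTop.comp ?_)
  have h5 : Tendsto (fun n => ‖den (m n) (g n) p‖ ^ 2) atTop (𝓝[>] 0) := by
    refine tendsto_nhdsWithin_iff.2 ⟨?_, Eventually.of_forall fun n => ?_⟩
    · simpa using h4.norm.pow 2
    · have := norm_pos_iff.2 (h3 n)
      exact pow_pos this 2
  exact ((tendsto_inv_nhdsGT_zero.comp h5).const_mul_atTop hp.2).const_mul_atTop hc

/-- The factorizations `|1/E|² = t⁻¹ · t/|E|²` and `|t/E|² = t · t/|E|²` fit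
`tendsto_integral_of_sq_le`, with `∫ t/|E|²` bounded by stability. Only `1/E` is assumed to
converge, and only the limit of `1/g` is produced, so that the case `g → ∞` is covered too. -/
theorem limit_equations {c : ℝ} (hc0 : 0 < c) {H : Measure (ℝ × ℝ)}
    (hH : ∀ᵐ p ∂H, 0 ≤ p.1 ∧ 0 < p.2) (ht : Integrable (fun p : ℝ × ℝ => p.2) H)
    (hti : Integrable (fun p : ℝ × ℝ => p.2⁻¹) H) {z m g : ℕ → ℂ} {z₀ m₀ : ℂ} {f : ℝ × ℝ → ℂ}
    (hS : ∀ n, SolvesCompanionSystem c H (z n) (m n) (g n))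
    (hst : ∀ n, IsStableSol c H ‖z n‖ (m n) (g n))
    (hz : Tendsto z atTop (𝓝 z₀)) (hm : Tendsto m atTop (𝓝 m₀))
    (hf : ∀ᵐ p ∂H, Tendsto (fun n => 1 / den (m n) (g n) p) atTop (𝓝 (f p))) :
    Integrable f H ∧ Integrable (fun p => (p.2 : ℂ) * f p) H ∧
      z₀ * m₀ = -(1 - (c : ℂ)) - c * ∫ p, f p ∂H ∧
      Tendsto (fun n => (g n)⁻¹) atTop (𝓝 (c * ∫ p, (p.2 : ℂ) * f p ∂H - z₀)) := by
  have hH2 : ∀ᵐ p ∂H, 0 ≤ p.2 := hH.mono fun p hp => hp.2.le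
  obtain ⟨C, hC⟩ := hz.norm.bddAbove_range
  have hq : ∀ n, Integrable (fun p => p.2 / ‖den (m n) (g n) p‖ ^ 2) H ∧
      c * ∫ p, p.2 / ‖den (m n) (g n) p‖ ^ 2 ∂H ≤ ‖z n‖ := fun n => by
    obtain ⟨β, r, -, -, -, h, -⟩ := hst n
    exact integral_le_of_quad_le hc0 measurable_snd hH2 (norm_nonneg _) (le_self_add.trans h)
  have hqC : ∀ n, ∫ p, p.2 / ‖den (m n) (g n) p‖ ^ 2 ∂H ≤ C / c := fun n => by
    rw [le_div_iff₀ hc0, mul_comm]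
    exact (hq n).2.trans (hC ⟨n, rfl⟩)
  have hq0 : ∀ n, ∀ᵐ p ∂H, 0 ≤ p.2 / ‖den (m n) (g n) p‖ ^ 2 := fun n =>
    hH2.mono fun p hp => by positivity
  obtain ⟨i1, t1⟩ := tendsto_integral_of_sq_le (fun n => (hS n).integrable_fst.1) hti
    (hH2.mono fun p hp => inv_nonneg.2 hp) (fun n => (hq n).1) hq0 hqC
    (fun n => hH.mono fun p hp => le_of_eq (by
      have := hp.2
      change ‖1 / den (m n) (g n) p‖ ^ 2 = _
      rw [norm_div, norm_one]
      field_simp)) hf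
  obtain ⟨i2, t2⟩ := tendsto_integral_of_sq_le (f₀ := fun p => (p.2 : ℂ) * f p)
    (fun n => (hS n).integrable_snd.1) ht hH2 (fun n => (hq n).1) hq0 hqC
    (fun n => hH.mono fun p hp => le_of_eq (by
      change ‖(p.2 : ℂ) / den (m n) (g n) p‖ ^ 2 = _
      rw [norm_div, Complex.norm_real, Real.norm_of_nonneg hp.2.le]
      ring)) (hf.mono fun p hp => by
        have := hp.const_mul (p.2 : ℂ)
        refine this.congr fun n => ?_
        rw [mul_one_div]; rfl)
  refine ⟨i1, i2, ?_, ?_⟩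
  · refine tendsto_nhds_unique (hz.mul hm) ?_
    refine (tendsto_const_nhds.sub (t1.const_mul (c : ℂ))).congr fun n => ?_
    exact (hS n).eq_fst.symm
  · refine ((t2.const_mul (c : ℂ)).sub hz).congr fun n => ?_
    have h := (hS n).eq_snd
    have : (g n)⁻¹ = c * ∫ p : ℝ × ℝ, (p.2 : ℂ) / (1 + (p.1 : ℂ) * g n + (p.2 : ℂ) * m n) ∂H - z n := by
      conv_rhs => rw [h]
      ring
    exact this.symm

/-- If `1/g → 0`, then `1/E` survives in the limit only on `s = 0`. Combining the two limit
equations yields `c H(s = 0) = -(1 - c)`. As `c ≤ 1`, the set `s = 0` is null, so the limit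
integrals vanish and the second equation reads `z₀ = 0`. -/
theorem not_tendsto_inv_zero {c : ℝ} (hc0 : 0 < c) (hc1 : c ≤ 1) {H : Measure (ℝ × ℝ)}
    [IsProbabilityMeasure H]
    (hH : ∀ᵐ p ∂H, 0 ≤ p.1 ∧ 0 < p.2) (ht : Integrable (fun p : ℝ × ℝ => p.2) H)
    (hti : Integrable (fun p : ℝ × ℝ => p.2⁻¹) H) {z m g : ℕ → ℂ} {z₀ m₀ : ℂ}
    (hS : ∀ n, SolvesCompanionSystem c H (z n) (m n) (g n))
    (hst : ∀ n, IsStableSol c H ‖z n‖ (m n) (g n))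
    (hz : Tendsto z atTop (𝓝 z₀)) (hz0 : z₀ ≠ 0) (hm : Tendsto m atTop (𝓝 m₀)) :
    ¬ Tendsto (fun n => (g n)⁻¹) atTop (𝓝 0) := by
  intro hg
  obtain ⟨C, hC⟩ := hz.norm.bddAbove_range
  have hqC : ∀ n, quad c H (fun p => p.2) (m n) (g n) ≤ ENNReal.ofReal C := fun n => by
    obtain ⟨β, r, -, -, -, h, -⟩ := hst n
    exact (le_self_add.trans h).trans (ENNReal.ofReal_le_ofReal (hC ⟨n, rfl⟩))
  set f : ℝ × ℝ → ℂ := fun p => if p.1 = 0 then 1 / (1 + (p.2 : ℂ) * m₀) else 0 with hf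
  have hnd := ae_not_tendsto_den_zero hc0 hH (fun n => (hS n).denom_ne) hqC
  have hnz : ∀ᵐ p ∂H, p.1 = 0 → 1 + (p.2 : ℂ) * m₀ ≠ 0 := by
    filter_upwards [hnd] with p hp h0 h1
    refine hp ?_
    rw [← h1]
    simp only [den, h0, Complex.ofReal_zero, zero_mul, add_zero]
    exact tendsto_const_nhds.add (hm.const_mul _)
  have hlim : ∀ᵐ p ∂H, Tendsto (fun n => 1 / den (m n) (g n) p) atTop (𝓝 (f p)) := by
    filter_upwards [hnz] with p hp
    by_cases h0 : p.1 = 0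
    · simp only [hf, h0, if_true, den, Complex.ofReal_zero, zero_mul, add_zero]
      exact tendsto_const_nhds.div (tendsto_const_nhds.add (hm.const_mul _)) (hp h0)
    · simp only [hf, h0, if_false]
      have h1 : Tendsto (fun n => (g n)⁻¹ / ((g n)⁻¹ + p.1 + p.2 * (m n * (g n)⁻¹))) atTop
          (𝓝 (0 / (0 + p.1 + p.2 * (m₀ * 0)))) := by
        refine hg.div ((hg.add_const _).add ((hm.mul hg).const_mul _)) ?_
        simpa using h0
      rw [zero_div] at h1
      refine h1.congr fun n => ?_
      have h2 : g n ≠ 0 := (hS n).aux_ne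
      have h3 : (g n)⁻¹ + p.1 + p.2 * (m n * (g n)⁻¹) = (g n)⁻¹ * den (m n) (g n) p := by
        rw [den]; field_simp
      rw [h3, ← div_div, div_self (inv_ne_zero h2)]
  obtain ⟨i1, i2, e1, e2⟩ := limit_equations hc0 hH ht hti hS hst hz hm hlim
  have e3 := tendsto_nhds_unique hg e2
  -- Because `(1 + t m₀) f` is the indicator of `s = 0`.
  have e4 : ∫ p, f p ∂H + m₀ * ∫ p, (p.2 : ℂ) * f p ∂H = H.real {p | p.1 = 0} := by
    rw [← integral_const_mul, ← integral_add i1 (i2.const_mul _)]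
    have hms : MeasurableSet {p : ℝ × ℝ | p.1 = 0} := measurable_fst (measurableSet_singleton 0)
    have : ∫ p, {p : ℝ × ℝ | p.1 = 0}.indicator (fun _ => (1 : ℂ)) p ∂H = H.real {p | p.1 = 0} := by
      rw [integral_indicator_const _ hms]; simp
    rw [← this]
    refine integral_congr_ae ?_
    filter_upwards [hnz] with p hp
    by_cases h0 : p.1 = 0
    · have := hp h0
      simp only [hf, h0, if_true, indicator, Set.mem_ofPred_eq]
      field_simp
    · simp [hf, h0, indicator]
  have e5 : ((c * H.real {p | p.1 = 0} : ℝ) : ℂ) = ((-(1 - c) : ℝ) : ℂ) := by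
    push_cast
    rw [← e4]
    have : z₀ = c * ∫ p, (p.2 : ℂ) * f p ∂H := (sub_eq_zero.1 e3.symm).symm
    rw [this] at e1
    linear_combination e1
  have e6 : c * H.real {p | p.1 = 0} = -(1 - c) := by exact_mod_cast e5
  have e7 : H.real {p | p.1 = 0} = 0 := by
    have h1 : 0 ≤ H.real {p : ℝ × ℝ | p.1 = 0} := measureReal_nonneg
    have h2 : c * H.real {p : ℝ × ℝ | p.1 = 0} ≤ 0 := by linarith
    by_contra hcon
    have : 0 < c * H.real {p : ℝ × ℝ | p.1 = 0} := by positivity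
    linarith
  have e8 : f =ᵐ[H] 0 := by
    have : H {p : ℝ × ℝ | p.1 = 0} = 0 := (measureReal_eq_zero_iff).1 e7
    have h2 : ∀ᵐ p ∂H, ¬ p.1 = 0 := by
      rw [ae_iff]; simpa using this
    filter_upwards [h2] with p hp
    simp [hf, hp]
  have e9 : ∫ p, (p.2 : ℂ) * f p ∂H = 0 := by
    rw [← integral_zero (ℝ × ℝ) ℂ (μ := H)]
    refine integral_congr_ae (e8.mono fun p hp => ?_)
    simp [hp]
  rw [e9] at e3
  simp at e3
  exact hz0 e3

/-- The moments are lower semicontinuous by Fatou, and the bounded slacks `β n`, `r n` converge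
along a subsequence. The non-closed condition `0 < β` has to be recovered separately. -/
theorem limit_stable {c : ℝ} (hc0 : 0 < c) {H : Measure (ℝ × ℝ)}
    [IsProbabilityMeasure H]
    (hH : ∀ᵐ p ∂H, 0 ≤ p.1 ∧ 0 < p.2) (ht : Integrable (fun p : ℝ × ℝ => p.2) H)
    (hti : Integrable (fun p : ℝ × ℝ => p.2⁻¹) H) {z m g : ℕ → ℂ} {z₀ m₀ g₀ : ℂ}
    (hS : ∀ n, SolvesCompanionSystem c H (z n) (m n) (g n))
    (hst : ∀ n, IsStableSol c H ‖z n‖ (m n) (g n))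
    (hz : Tendsto z atTop (𝓝 z₀)) (hm : Tendsto m atTop (𝓝 m₀))
    (hg : Tendsto g atTop (𝓝 g₀)) (hg0 : g₀ ≠ 0) :
    SolvesCompanionSystem c H z₀ m₀ g₀ ∧ IsStableSol c H ‖z₀‖ m₀ g₀ := by
  obtain ⟨C, hC⟩ := hz.norm.bddAbove_range
  have hqC : ∀ n, quad c H (fun p => p.2) (m n) (g n) ≤ ENNReal.ofReal C := fun n => by
    obtain ⟨β, r, -, -, -, h, -⟩ := hst n
    exact (le_self_add.trans h).trans (ENNReal.ofReal_le_ofReal (hC ⟨n, rfl⟩))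
  have hden : ∀ p, Tendsto (fun n => den (m n) (g n) p) atTop (𝓝 (den m₀ g₀ p)) := fun p =>
    (tendsto_const_nhds.add (hg.const_mul _)).add (hm.const_mul _)
  have hne : ∀ᵐ p ∂H, den m₀ g₀ p ≠ 0 := by
    filter_upwards [ae_not_tendsto_den_zero hc0 hH (fun n => (hS n).denom_ne) hqC] with p hp h0
    exact hp (h0 ▸ hden p)
  have hlim : ∀ᵐ p ∂H, Tendsto (fun n => 1 / den (m n) (g n) p) atTop (𝓝 (1 / den m₀ g₀ p)) :=
    hne.mono fun p hp => tendsto_const_nhds.div (hden p) hp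
  obtain ⟨i1, i2, e1, e2⟩ := limit_equations hc0 hH ht hti hS hst hz hm hlim
  have e3 := tendsto_nhds_unique (hg.inv₀ hg0) e2
  simp only [mul_one_div] at i2 e3
  refine ⟨⟨hne, i1, i2, hg0, e1, ?_⟩, ?_⟩
  · change z₀ = -1 / g₀ + c * ∫ p : ℝ × ℝ, (p.2 : ℂ) / den m₀ g₀ p ∂H
    rw [neg_div, one_div, e3]; ring
  choose β r hβ hr b1 b2 b3 using hst
  have hgi : Tendsto (fun n => 1 / ‖g n‖ ^ 2) atTop (𝓝 (1 / ‖g₀‖ ^ 2)) :=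
    tendsto_const_nhds.div (hg.norm.pow 2) (pow_ne_zero 2 (norm_ne_zero_iff.2 hg0))
  have hβle : ∀ n, β n ≤ 1 / ‖g n‖ ^ 2 := fun n =>
    (ENNReal.ofReal_le_ofReal_iff (by positivity)).1 (le_add_self.trans (b1 n))
  have hrle : ∀ n, r n ≤ ‖z n‖ := fun n =>
    (ENNReal.ofReal_le_ofReal_iff (norm_nonneg _)).1 (le_add_self.trans (b2 n))
  obtain ⟨B, hB⟩ := hgi.bddAbove_range
  obtain ⟨β₀, hβ₀, φ, hφ, hφβ⟩ := isCompact_Icc.tendsto_subseq (x := β) (s := Icc 0 B)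
    (fun n => ⟨(hβ n).le, (hβle n).trans (hB ⟨n, rfl⟩)⟩)
  obtain ⟨r₀, hr₀, ψ, hψ, hψr⟩ := isCompact_Icc.tendsto_subseq (x := r ∘ φ) (s := Icc 0 C)
    (fun n => ⟨hr _, (hrle _).trans (hC ⟨_, rfl⟩)⟩)
  set θ := φ ∘ ψ with hθ
  have hθt : Tendsto θ atTop atTop := hφ.tendsto_atTop.comp hψ.tendsto_atTop
  have hβt : Tendsto (β ∘ θ) atTop (𝓝 β₀) := hφβ.comp hψ.tendsto_atTop
  have hrt : Tendsto (r ∘ θ) atTop (𝓝 r₀) := hψr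
  have hmθ := hm.comp hθt
  have hgθ := hg.comp hθt
  have mst : Measurable fun p : ℝ × ℝ => p.1 * p.2 := measurable_fst.mul measurable_snd
  have mtt : Measurable fun p : ℝ × ℝ => p.2 ^ 2 := measurable_snd.pow_const 2
  have key : ∀ {k : ℝ × ℝ → ℝ} (_ : Measurable k) {a y : ℕ → ℝ} {a₀ y₀ : ℝ},
      Tendsto a atTop (𝓝 a₀) → Tendsto y atTop (𝓝 y₀) → (∀ n, 0 ≤ a n) → (∀ n, a n ≤ y n) →
      (∀ n, quad c H k (m (θ n)) (g (θ n)) + ENNReal.ofReal (a n) ≤ ENNReal.ofReal (y n)) →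
      quad c H k m₀ g₀ + ENNReal.ofReal a₀ ≤ ENNReal.ofReal y₀ := by
    intro k hk a y a₀ y₀ ha hy ha0 hay h
    have h1 : quad c H k m₀ g₀ ≤ ENNReal.ofReal (y₀ - a₀) := by
      calc quad c H k m₀ g₀ ≤ liminf (fun n => quad c H k (m (θ n)) (g (θ n))) atTop :=
            quad_le_liminf hk hmθ hgθ hne
        _ ≤ liminf (fun n => ENNReal.ofReal (y n - a n)) atTop := by
            refine liminf_le_liminf (Eventually.of_forall fun n => ?_)
            rw [ENNReal.ofReal_sub _ (ha0 n)]
            exact ENNReal.le_sub_of_add_le_right ENNReal.ofReal_ne_top (h n)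
        _ = _ := (ENNReal.tendsto_ofReal (hy.sub ha)).liminf_eq
    calc quad c H k m₀ g₀ + ENNReal.ofReal a₀
        ≤ ENNReal.ofReal (y₀ - a₀) + ENNReal.ofReal a₀ := by gcongr
      _ = ENNReal.ofReal y₀ := by
          rw [← ENNReal.ofReal_add (sub_nonneg.2 (le_of_tendsto_of_tendsto' ha hy hay))
            (ge_of_tendsto' ha ha0), sub_add_cancel]
  have c1 := key mst hβt (hgi.comp hθt) (fun n => (hβ _).le) (fun n => hβle _) fun n => b1 _
  have c2 := key measurable_snd hrt (hz.norm.comp hθt) (fun n => hr _) (fun n => hrle _) fun n => b2 _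
  have c3 : quad c H (fun p => p.1) m₀ g₀ * quad c H (fun p => p.2 ^ 2) m₀ g₀
      ≤ ENNReal.ofReal (β₀ * r₀) := by
    calc quad c H (fun p => p.1) m₀ g₀ * quad c H (fun p => p.2 ^ 2) m₀ g₀
        ≤ liminf (fun n => quad c H (fun p => p.1) (m (θ n)) (g (θ n))) atTop
          * liminf (fun n => quad c H (fun p => p.2 ^ 2) (m (θ n)) (g (θ n))) atTop :=
          mul_le_mul' (quad_le_liminf measurable_fst hmθ hgθ hne) (quad_le_liminf mtt hmθ hgθ hne)
      _ ≤ liminf (fun n => quad c H (fun p => p.1) (m (θ n)) (g (θ n))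
            * quad c H (fun p => p.2 ^ 2) (m (θ n)) (g (θ n))) atTop := ENNReal.le_liminf_mul
      _ ≤ liminf (fun n => ENNReal.ofReal (β (θ n) * r (θ n))) atTop :=
          liminf_le_liminf (Eventually.of_forall fun n => b3 _)
      _ = _ := (ENNReal.tendsto_ofReal (hβt.mul hrt)).liminf_eq
  have hquad0 : ∀ {k : ℝ × ℝ → ℝ}, Measurable k → quad c H k m₀ g₀ = 0 → ∀ᵐ p ∂H, k p ≤ 0 := by
    intro k hk h0
    have hmeas : Measurable fun p => ENNReal.ofReal (c * (k p / ‖den m₀ g₀ p‖ ^ 2)) :=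
      ((hk.div ((measurable_den _ _).norm.pow_const 2)).const_mul c).ennreal_ofReal
    rw [quad, lintegral_eq_zero_iff hmeas] at h0
    filter_upwards [h0, hne] with p h1 h2
    have h3 : c * (k p / ‖den m₀ g₀ p‖ ^ 2) ≤ 0 := ENNReal.ofReal_eq_zero.1 h1
    by_contra hcon
    push Not at hcon
    have := norm_pos_iff.2 h2
    have : 0 < c * (k p / ‖den m₀ g₀ p‖ ^ 2) := by positivity
    linarith
  -- Either `s = 0` almost everywhere, the `st` moment vanishes and `β = 1 / ‖g₀‖ ^ 2` is available;
  -- or the `s` and `t²` moments are both nonzero, and the determinant inequality forces `β₀ r₀ >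
  -- 0`.
  by_cases hs : quad c H (fun p => p.1) m₀ g₀ = 0
  · have hs0 : ∀ᵐ p ∂H, p.1 = 0 := by
      filter_upwards [hquad0 measurable_fst hs, hH] with p h1 h2
      exact le_antisymm h1 h2.1
    have hst0 : quad c H (fun p => p.1 * p.2) m₀ g₀ = 0 := by
      rw [quad, ← lintegral_zero (μ := H)]
      refine lintegral_congr_ae (hs0.mono fun p hp => ?_)
      simp [hp]
    have := norm_pos_iff.2 hg0
    refine ⟨1 / ‖g₀‖ ^ 2, r₀, by positivity, hr₀.1, ?_, c2, ?_⟩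
    · rw [hst0, zero_add]
    · rw [hs, zero_mul]; exact zero_le
  · have htt : quad c H (fun p => p.2 ^ 2) m₀ g₀ ≠ 0 := by
      intro h0
      have h1 := hquad0 mtt h0
      have h2 : ∀ᵐ p ∂H, False := by
        filter_upwards [h1, hH] with p h1 h2
        have := pow_pos h2.2 2
        linarith
      have := h2.exists
      simp at this
    have h1 : 0 < β₀ * r₀ := by
      by_contra hcon
      rw [ENNReal.ofReal_eq_zero.2 (not_lt.1 hcon)] at c3
      exact mul_ne_zero hs htt (le_antisymm c3 zero_le)
    exact ⟨β₀, r₀, pos_of_mul_pos_left h1 hr₀.1, hr₀.1, c1, c2, c3⟩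

/-! ### Uniqueness of stable solutions on the real line -/

/-- The alternative comes from `0 * ⊤ = 0` in `ENNReal`: when `s = 0` almost everywhere, the product
bound says nothing about the `t²` moment. Otherwise neither factor is zero, so both are finite. -/
theorem IsStableSol.exists_real {c : ℝ} (hc : 0 < c) {H : Measure (ℝ × ℝ)}
    [IsProbabilityMeasure H] (hH : ∀ᵐ p ∂H, 0 ≤ p.1 ∧ 0 < p.2) {R : ℝ} (hR : 0 ≤ R) {m g : ℂ}
    (hne : ∀ᵐ p ∂H, den m g p ≠ 0) (h : IsStableSol c H R m g) :
    ∃ β r : ℝ, 0 < β ∧ 0 ≤ r ∧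
      Integrable (fun p => p.1 * p.2 / ‖den m g p‖ ^ 2) H ∧
      c * ∫ p, p.1 * p.2 / ‖den m g p‖ ^ 2 ∂H + β ≤ (1 / ‖g‖) ^ 2 ∧
      Integrable (fun p => p.2 / ‖den m g p‖ ^ 2) H ∧
      c * ∫ p, p.2 / ‖den m g p‖ ^ 2 ∂H + r ≤ R ∧
      ((∀ᵐ p ∂H, p.1 = 0) ∨
        (Integrable (fun p => p.1 / ‖den m g p‖ ^ 2) H ∧
         Integrable (fun p => p.2 ^ 2 / ‖den m g p‖ ^ 2) H ∧
         (c * ∫ p, p.1 / ‖den m g p‖ ^ 2 ∂H) * (c * ∫ p, p.2 ^ 2 / ‖den m g p‖ ^ 2 ∂H)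
           ≤ β * r)) := by
  obtain ⟨β, r, hβ, hr, h1, h2, h3⟩ := h
  have k1 : ∀ᵐ p ∂H, 0 ≤ p.1 := hH.mono fun p hp => hp.1
  have k2 : ∀ᵐ p ∂H, 0 ≤ p.2 := hH.mono fun p hp => hp.2.le
  have k12 : ∀ᵐ p ∂H, 0 ≤ p.1 * p.2 := hH.mono fun p hp => mul_nonneg hp.1 hp.2.le
  have k22 : ∀ᵐ p ∂H, 0 ≤ p.2 ^ 2 := ae_of_all _ fun p => sq_nonneg _
  have m12 : Measurable fun p : ℝ × ℝ => p.1 * p.2 := measurable_fst.mul measurable_snd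
  have m22 : Measurable fun p : ℝ × ℝ => p.2 ^ 2 := measurable_snd.pow_const 2
  have i12 := integrable_of_quad_ne_top hc m12 k12
    ((le_self_add.trans h1).trans_lt ENNReal.ofReal_lt_top).ne
  have i2 := integrable_of_quad_ne_top hc measurable_snd k2
    ((le_self_add.trans h2).trans_lt ENNReal.ofReal_lt_top).ne
  have n12 : 0 ≤ c * ∫ p, p.1 * p.2 / ‖den m g p‖ ^ 2 ∂H :=
    mul_nonneg hc.le (integral_nonneg_of_ae (k12.mono fun p hp => by positivity))
  have n2 : 0 ≤ c * ∫ p, p.2 / ‖den m g p‖ ^ 2 ∂H :=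
    mul_nonneg hc.le (integral_nonneg_of_ae (k2.mono fun p hp => by positivity))
  rw [quad_eq_ofReal hc.le k12 i12, ← ENNReal.ofReal_add n12 hβ.le,
    ENNReal.ofReal_le_ofReal_iff (by positivity)] at h1
  rw [quad_eq_ofReal hc.le k2 i2, ← ENNReal.ofReal_add n2 hr, ENNReal.ofReal_le_ofReal_iff hR] at h2
  refine ⟨β, r, hβ, hr, i12, by rwa [div_pow, one_pow], i2, h2, ?_⟩
  have hquad0 : ∀ {k : ℝ × ℝ → ℝ}, Measurable k → quad c H k m g = 0 → ∀ᵐ p ∂H, k p ≤ 0 := by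
    intro k hk h0
    have hmeas : Measurable fun p => ENNReal.ofReal (c * (k p / ‖den m g p‖ ^ 2)) :=
      ((hk.div ((measurable_den _ _).norm.pow_const 2)).const_mul c).ennreal_ofReal
    rw [quad, lintegral_eq_zero_iff hmeas] at h0
    filter_upwards [h0, hne] with p h1 h2
    have h3 : c * (k p / ‖den m g p‖ ^ 2) ≤ 0 := ENNReal.ofReal_eq_zero.1 h1
    by_contra hcon
    push Not at hcon
    have := norm_pos_iff.2 h2
    have : 0 < c * (k p / ‖den m g p‖ ^ 2) := by positivity
    linarith
  by_cases hs : quad c H (fun p => p.1) m g = 0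
  · left
    filter_upwards [hquad0 measurable_fst hs, hH] with p h1 h2
    exact le_antisymm h1 h2.1
  · right
    have htt : quad c H (fun p => p.2 ^ 2) m g ≠ 0 := by
      intro h0
      have h2 : ∀ᵐ p ∂H, False := by
        filter_upwards [hquad0 m22 h0, hH] with p h1 h2
        have := pow_pos h2.2 2
        linarith
      have := h2.exists
      simp at this
    have hlt := h3.trans_lt ENNReal.ofReal_lt_top
    have i1 := integrable_of_quad_ne_top hc measurable_fst k1
      (ENNReal.lt_top_of_mul_ne_top_left hlt.ne htt).ne
    have i22 := integrable_of_quad_ne_top hc m22 k22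
      (ENNReal.lt_top_of_mul_ne_top_right hlt.ne hs).ne
    refine ⟨i1, i22, ?_⟩
    have n1 : 0 ≤ c * ∫ p, p.1 / ‖den m g p‖ ^ 2 ∂H :=
      mul_nonneg hc.le (integral_nonneg_of_ae (k1.mono fun p hp => by positivity))
    rwa [quad_eq_ofReal hc.le k1 i1, quad_eq_ofReal hc.le k22 i22, ← ENNReal.ofReal_mul n1,
      ENNReal.ofReal_le_ofReal_iff (by positivity)] at h3

/-- Cauchy-Schwarz for the mixed moments, the entries of the difference system, in terms of the
moments of each solution. -/
theorem norm_integral_div_den_mul_den_le {c : ℝ} {H : Measure (ℝ × ℝ)}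
    {k : ℝ × ℝ → ℝ} (hkm : Measurable k) (hk0 : ∀ᵐ p ∂H, 0 ≤ k p) {m g m' g' : ℂ}
    (h : Integrable (fun p => k p / ‖den m g p‖ ^ 2) H)
    (h' : Integrable (fun p => k p / ‖den m' g' p‖ ^ 2) H) :
    Integrable (fun p => (k p : ℂ) / (den m g p * den m' g' p)) H ∧
    ‖(c : ℂ) * ∫ p, (k p : ℂ) / (den m g p * den m' g' p) ∂H‖ ^ 2
      ≤ (c * ∫ p, k p / ‖den m g p‖ ^ 2 ∂H) * (c * ∫ p, k p / ‖den m' g' p‖ ^ 2 ∂H) := by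
  have hn : ∀ᵐ p ∂H, ‖(k p : ℂ) / (den m g p * den m' g' p)‖
      = k p * (‖den m g p‖⁻¹ * ‖den m' g' p‖⁻¹) := by
    filter_upwards [hk0] with p hp
    rw [norm_div, norm_mul, Complex.norm_real, Real.norm_of_nonneg hp, div_eq_mul_inv, mul_inv]
  have hi : Integrable (fun p => (k p : ℂ) / (den m g p * den m' g' p)) H := by
    refine (h.add h').mono' (((Complex.measurable_ofReal.comp hkm).div
      ((measurable_den _ _).mul (measurable_den _ _))).aestronglyMeasurable) ?_
    filter_upwards [hn, hk0] with p hp hkp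
    rw [hp, Pi.add_apply, div_eq_mul_inv, div_eq_mul_inv, ← mul_add, ← inv_pow, ← inv_pow]
    refine mul_le_mul_of_nonneg_left ?_ hkp
    nlinarith [sq_nonneg (‖den m g p‖⁻¹ - ‖den m' g' p‖⁻¹), inv_nonneg.2 (norm_nonneg (den m g p)),
      inv_nonneg.2 (norm_nonneg (den m' g' p)), sq_nonneg (‖den m g p‖⁻¹ + ‖den m' g' p‖⁻¹)]
  refine ⟨hi, ?_⟩
  have h1 := sq_integral_le_of_sq_le_mul hi.norm h h' (hk0.mono fun p hp => by positivity)
    (hk0.mono fun p hp => by positivity) (by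
      filter_upwards [hn] with p hp
      rw [hp]
      apply le_of_eq
      rw [div_eq_mul_inv, div_eq_mul_inv, ← inv_pow, ← inv_pow]
      ring)
  have h2 : ‖∫ p, (k p : ℂ) / (den m g p * den m' g' p) ∂H‖ ^ 2
      ≤ (∫ p, ‖(k p : ℂ) / (den m g p * den m' g' p)‖ ∂H) ^ 2 :=
    pow_le_pow_left₀ (norm_nonneg _) (norm_integral_le_integral_norm _) 2
  rw [norm_mul, mul_pow, Complex.norm_real, Real.norm_eq_abs, sq_abs]
  calc c ^ 2 * ‖∫ p, (k p : ℂ) / (den m g p * den m' g' p) ∂H‖ ^ 2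
      ≤ c ^ 2 * ((∫ p, k p / ‖den m g p‖ ^ 2 ∂H) * ∫ p, k p / ‖den m' g' p‖ ^ 2 ∂H) := by
        gcongr
        exact h2.trans h1
    _ = _ := by ring

/-- A reversed Cauchy-Schwarz (Aczél) inequality: `J + √(β β')` is at most `√((e + β)(e' + β'))`. It
keeps the diagonal entry `1/(g g') - J12` of the difference system away from zero. -/
theorem sqrt_mul_le_mul_sub {e e' β β' y y' J : ℝ} (he : 0 ≤ e) (he' : 0 ≤ e') (hβ : 0 ≤ β)
    (hβ' : 0 ≤ β') (hy : 0 ≤ y) (hy' : 0 ≤ y') (hJ : J ^ 2 ≤ e * e')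
    (h : e + β ≤ y ^ 2) (h' : e' + β' ≤ y' ^ 2) : √(β * β') ≤ y * y' - J := by
  set q := √(β * β') with hq
  have hq0 : 0 ≤ q := Real.sqrt_nonneg _
  have hq2 : q ^ 2 = β * β' := Real.sq_sqrt (mul_nonneg hβ hβ')
  have h1 : 2 * (J * q) ≤ e * β' + e' * β := by
    refine (abs_le_of_sq_le_sq' ?_ (by positivity)).2
    have : (J * q) ^ 2 ≤ (e * e') * (β * β') := by
      rw [mul_pow, hq2]; gcongr
    nlinarith [sq_nonneg (e * β' - e' * β)]
  have h2 : J + q ≤ y * y' := by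
    refine (abs_le_of_sq_le_sq' ?_ (by positivity)).2
    calc (J + q) ^ 2 = J ^ 2 + 2 * (J * q) + q ^ 2 := by ring
      _ ≤ e * e' + (e * β' + e' * β) + β * β' := by rw [hq2]; gcongr
      _ = (e + β) * (e' + β') := by ring
      _ ≤ y ^ 2 * y' ^ 2 := by gcongr
      _ = (y * y') ^ 2 := by ring
  linarith

/-- The (divided) differences of the companion system at two stable solutions form an
invertible system, unless the two denominators are complex conjugate to each other. -/
theorem stable_pair_kernel {c : ℝ} (hc : 0 < c) {H : Measure (ℝ × ℝ)}
    [IsProbabilityMeasure H] (hH : ∀ᵐ p ∂H, 0 ≤ p.1 ∧ 0 < p.2) {x : ℝ} {m g m' g' : ℂ}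
    (hne : ∀ᵐ p ∂H, den m g p ≠ 0) (hne' : ∀ᵐ p ∂H, den m' g' p ≠ 0)
    (h : IsStableSol c H ‖(x : ℂ)‖ m g) (h' : IsStableSol c H ‖(x : ℂ)‖ m' g') {u w : ℂ}
    (iA : Integrable (fun p : ℝ × ℝ => (p.1 * w + p.2 * u) / (den m g p * den m' g' p)) H)
    (hA : x * u = c * ∫ p : ℝ × ℝ, (p.1 * w + p.2 * u) / (den m g p * den m' g' p) ∂H)
    (iB : Integrable (fun p : ℝ × ℝ => p.2 * (p.1 * w + p.2 * u) / (den m g p * den m' g' p)) H)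
    (hB : w / (g * g')
      = c * ∫ p : ℝ × ℝ, p.2 * (p.1 * w + p.2 * u) / (den m g p * den m' g' p) ∂H) :
    (u = 0 → w = 0) ∧
      (0 < x → u ≠ 0 → ∀ᵐ p ∂H, den m g p = (starRingEnd ℂ) (den m' g' p)) := by
  obtain ⟨β, r, hβ, hr, i12, l12, i2, l2, hd⟩ := h.exists_real hc hH (norm_nonneg _) hne
  obtain ⟨β', r', hβ', hr', i12', l12', i2', l2', hd'⟩ := h'.exists_real hc hH (norm_nonneg _) hne'
  have k1 : ∀ᵐ p ∂H, 0 ≤ p.1 := hH.mono fun p hp => hp.1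
  have k2 : ∀ᵐ p ∂H, 0 ≤ p.2 := hH.mono fun p hp => hp.2.le
  have k12 : ∀ᵐ p ∂H, 0 ≤ p.1 * p.2 := hH.mono fun p hp => mul_nonneg hp.1 hp.2.le
  have k22 : ∀ᵐ p ∂H, 0 ≤ p.2 ^ 2 := ae_of_all _ fun p => sq_nonneg _
  have m12 : Measurable fun p : ℝ × ℝ => p.1 * p.2 := measurable_fst.mul measurable_snd
  have m22 : Measurable fun p : ℝ × ℝ => p.2 ^ 2 := measurable_snd.pow_const 2
  obtain ⟨j12, b12⟩ := norm_integral_div_den_mul_den_le (c := c) m12 k12 i12 i12'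
  obtain ⟨j2, b2⟩ := norm_integral_div_den_mul_den_le (c := c) measurable_snd k2 i2 i2'
  push_cast at j12 b12
  set J12 : ℂ := c * ∫ p : ℝ × ℝ, (p.1 * p.2 : ℂ) / (den m g p * den m' g' p) ∂H with hJ12
  set J2 : ℂ := c * ∫ p : ℝ × ℝ, (p.2 : ℂ) / (den m g p * den m' g' p) ∂H with hJ2
  set J22 : ℂ := c * ∫ p : ℝ × ℝ, (p.2 ^ 2 : ℂ) / (den m g p * den m' g' p) ∂H with hJ22
  set J1 : ℂ := c * ∫ p : ℝ × ℝ, (p.1 : ℂ) / (den m g p * den m' g' p) ∂H with hJ1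
  -- splitting the two linear equations
  have eB : w * (1 / (g * g') - J12) = u * J22 := by
    have e1 : ∫ p : ℝ × ℝ, p.2 * (p.1 * w + p.2 * u) / (den m g p * den m' g' p) ∂H
        - ∫ p : ℝ × ℝ, w * ((p.1 * p.2 : ℂ) / (den m g p * den m' g' p)) ∂H
        = ∫ p : ℝ × ℝ, u * ((p.2 ^ 2 : ℂ) / (den m g p * den m' g' p)) ∂H := by
      rw [← integral_sub iB (j12.const_mul w)]
      refine integral_congr_ae (ae_of_all _ fun p => ?_)
      simp only
      ring
    rw [integral_const_mul, integral_const_mul] at e1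
    rw [hJ12, hJ22]
    linear_combination hB + (c : ℂ) * e1
  have eA : u * (x - J2) = w * J1 := by
    have e1 : ∫ p : ℝ × ℝ, (p.1 * w + p.2 * u) / (den m g p * den m' g' p) ∂H
        - ∫ p : ℝ × ℝ, u * ((p.2 : ℂ) / (den m g p * den m' g' p)) ∂H
        = ∫ p : ℝ × ℝ, w * ((p.1 : ℂ) / (den m g p * den m' g' p)) ∂H := by
      rw [← integral_sub iA (j2.const_mul u)]
      refine integral_congr_ae (ae_of_all _ fun p => ?_)
      simp only
      ring
    rw [integral_const_mul, integral_const_mul] at e1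
    rw [hJ1, hJ2]
    linear_combination hA + (c : ℂ) * e1
  have n12 : 0 ≤ c * ∫ p, p.1 * p.2 / ‖den m g p‖ ^ 2 ∂H :=
    mul_nonneg hc.le (integral_nonneg_of_ae (k12.mono fun p hp => by positivity))
  have n12' : 0 ≤ c * ∫ p, p.1 * p.2 / ‖den m' g' p‖ ^ 2 ∂H :=
    mul_nonneg hc.le (integral_nonneg_of_ae (k12.mono fun p hp => by positivity))
  have hΛ : √(β * β') ≤ ‖1 / (g * g') - J12‖ := by
    have h1 := sqrt_mul_le_mul_sub n12 n12' hβ.le hβ'.le (by positivity) (by positivity)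
      b12 l12 l12'
    refine h1.trans (le_trans (le_of_eq ?_) (norm_sub_norm_le _ _))
    rw [norm_div, norm_one, norm_mul g g', one_div_mul_one_div]
  have hββ : 0 < √(β * β') := Real.sqrt_pos.2 (mul_pos hβ hβ')
  refine ⟨fun hu => ?_, fun hx hu => ?_⟩
  · rw [hu, zero_mul] at eB
    exact (mul_eq_zero.1 eB).resolve_right (norm_pos_iff.1 (hββ.trans_le hΛ))
  rw [Complex.norm_real, Real.norm_of_nonneg hx.le] at l2 l2'
  have hnu : 0 < ‖u‖ := norm_pos_iff.2 hu
  -- Eliminating `w` from `eA` and `eB` gives `|x - J2| |1/(g g') - J12| = |J1| |J22|` when `w ≠ 0`.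
  -- The second factor is at least `√(β β')`, and the right side is at most `√(β r β' r')`. The
  -- proof uses squared norms, which also covers `w = 0`.
  have hrr : ‖(x : ℂ) - J2‖ ^ 2 ≤ r * r' := by
    have hs0 : (∀ᵐ p ∂H, p.1 = 0) → ‖(x : ℂ) - J2‖ ^ 2 ≤ r * r' := by
      intro h0
      have : J1 = 0 := by
        rw [hJ1, mul_eq_zero]; right
        rw [← integral_zero (ℝ × ℝ) ℂ (μ := H)]
        refine integral_congr_ae (h0.mono fun p hp => ?_)
        simp [hp]
      rw [this, mul_zero] at eA
      rw [(mul_eq_zero.1 eA).resolve_left hu]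
      simp only [norm_zero, ne_eq, OfNat.ofNat_ne_zero, not_false_eq_true, zero_pow]
      positivity
    rcases hd with h0 | ⟨i1, i22, hd⟩
    · exact hs0 h0
    rcases hd' with h0 | ⟨i1', i22', hd'⟩
    · exact hs0 h0
    obtain ⟨-, b1⟩ := norm_integral_div_den_mul_den_le (c := c) measurable_fst k1 i1 i1'
    obtain ⟨-, b22⟩ := norm_integral_div_den_mul_den_le (c := c) m22 k22 i22 i22'
    push_cast at b22
    rw [← hJ1] at b1
    rw [← hJ22] at b22
    set S := c * ∫ p, p.1 / ‖den m g p‖ ^ 2 ∂H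
    set S' := c * ∫ p, p.1 / ‖den m' g' p‖ ^ 2 ∂H
    set T := c * ∫ p, p.2 ^ 2 / ‖den m g p‖ ^ 2 ∂H
    set T' := c * ∫ p, p.2 ^ 2 / ‖den m' g' p‖ ^ 2 ∂H
    have S0' : 0 ≤ S' :=
      mul_nonneg hc.le (integral_nonneg_of_ae (k1.mono fun p hp => by positivity))
    have T0' : 0 ≤ T' :=
      mul_nonneg hc.le (integral_nonneg_of_ae (k22.mono fun p hp => by positivity))
    have S0 : 0 ≤ S :=
      mul_nonneg hc.le (integral_nonneg_of_ae (k1.mono fun p hp => by positivity))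
    have T0 : 0 ≤ T :=
      mul_nonneg hc.le (integral_nonneg_of_ae (k22.mono fun p hp => by positivity))
    have e1 : ‖w‖ ^ 2 * ‖1 / (g * g') - J12‖ ^ 2 = ‖u‖ ^ 2 * ‖J22‖ ^ 2 := by
      rw [← mul_pow, ← norm_mul, eB, norm_mul, mul_pow]
    have e2 : ‖u‖ ^ 2 * ‖(x : ℂ) - J2‖ ^ 2 = ‖w‖ ^ 2 * ‖J1‖ ^ 2 := by
      rw [← mul_pow, ← norm_mul, eA, norm_mul, mul_pow]
    have e3 : β * β' ≤ ‖1 / (g * g') - J12‖ ^ 2 := by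
      rw [← Real.sq_sqrt (mul_pos hβ hβ').le]
      gcongr
    have e4 : ‖w‖ ^ 2 * (β * β') ≤ ‖u‖ ^ 2 * (T * T') :=
      calc ‖w‖ ^ 2 * (β * β') ≤ ‖w‖ ^ 2 * ‖1 / (g * g') - J12‖ ^ 2 := by gcongr
        _ = ‖u‖ ^ 2 * ‖J22‖ ^ 2 := e1
        _ ≤ _ := by gcongr
    have e5 : (β * β' * ‖u‖ ^ 2) * ‖(x : ℂ) - J2‖ ^ 2 ≤ (β * β' * ‖u‖ ^ 2) * (r * r') :=
      calc (β * β' * ‖u‖ ^ 2) * ‖(x : ℂ) - J2‖ ^ 2 = (‖w‖ ^ 2 * (β * β')) * ‖J1‖ ^ 2 := by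
            rw [mul_assoc, e2]; ring
        _ ≤ (‖u‖ ^ 2 * (T * T')) * (S * S') := by gcongr
        _ = ‖u‖ ^ 2 * ((S * T) * (S' * T')) := by ring
        _ ≤ ‖u‖ ^ 2 * ((β * r) * (β' * r')) := by gcongr
        _ = _ := by ring
    exact le_of_mul_le_mul_left e5 (by positivity)
  -- From `|x - J2| ≤ √(r r') ≤ (r + r') / 2`, with `r` and `r'` at most `x` minus the respective
  -- `t` moments. This reverses the Cauchy-Schwarz bound for `J2`, hence equality must hold.
  have hre : c * ∫ p, p.2 / ‖den m g p‖ ^ 2 ∂H + c * ∫ p, p.2 / ‖den m' g' p‖ ^ 2 ∂H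
      ≤ 2 * J2.re := by
    have h1 : ‖(x : ℂ) - J2‖ ≤ (r + r') / 2 := by
      refine (abs_le_of_sq_le_sq' ?_ (by positivity)).2
      nlinarith [sq_nonneg (r - r')]
    have h2 : x - J2.re ≤ ‖(x : ℂ) - J2‖ := by
      have := Complex.re_le_norm ((x : ℂ) - J2)
      simpa using this
    linarith
  have hJre : J2.re = c * ∫ p : ℝ × ℝ, ((p.2 : ℂ) / (den m g p * den m' g' p)).re ∂H := by
    have h1 := integral_re j2
    simp only [RCLike.re_eq_complex_re] at h1
    rw [hJ2, Complex.re_ofReal_mul, h1]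
  have jre : Integrable (fun p : ℝ × ℝ => ((p.2 : ℂ) / (den m g p * den m' g' p)).re) H := j2.re
  -- The integral of `t |1/E - conj (1/E')|²` is the sum of the two `t` moments minus twice the real
  -- part of the mixed one, so `hre` makes it vanish.
  set D : ℝ × ℝ → ℝ := fun p =>
    p.2 * ‖(den m g p)⁻¹ - (starRingEnd ℂ) (den m' g' p)⁻¹‖ ^ 2 with hD
  have hDeq : ∀ p : ℝ × ℝ, D p = 1 * (p.2 / ‖den m g p‖ ^ 2) + 1 * (p.2 / ‖den m' g' p‖ ^ 2)
      + (-2) * ((p.2 : ℂ) / (den m g p * den m' g' p)).re := by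
    intro p
    have h1 : ((p.2 : ℂ) / (den m g p * den m' g' p)).re
        = p.2 * ((den m g p)⁻¹ * (den m' g' p)⁻¹).re := by
      rw [div_eq_mul_inv, Complex.re_ofReal_mul, mul_inv]
    rw [h1, hD]
    simp only [div_eq_mul_inv, ← inv_pow, ← norm_inv]
    generalize (den m g p)⁻¹ = A
    generalize (den m' g' p)⁻¹ = B
    simp only [← Complex.normSq_eq_norm_sq, Complex.normSq_apply, Complex.mul_re, Complex.sub_re,
      Complex.sub_im, Complex.conj_re, Complex.conj_im]
    ring
  have hD0 : 0 ≤ᵐ[H] D := k2.mono fun p hp => by simp only [hD, Pi.zero_apply]; positivity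
  have hDi : Integrable D H := by
    rw [funext hDeq]
    exact ((i2.const_mul 1).add (i2'.const_mul 1)).add (jre.const_mul (-2))
  have hDint : c * ∫ p, D p ∂H ≤ 0 := by
    simp_rw [hDeq]
    rw [integral_linear_comb₃ i2 i2' jre]
    rw [hJre] at hre
    linarith
  have hDz : ∫ p, D p ∂H = 0 := by
    refine le_antisymm ?_ (integral_nonneg_of_ae hD0)
    by_contra hcon
    have := mul_pos hc (not_le.1 hcon)
    linarith
  filter_upwards [(integral_eq_zero_iff_of_nonneg_ae hD0 hDi).1 hDz, hH] with p h1 h2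
  have h3 : ‖(den m g p)⁻¹ - (starRingEnd ℂ) (den m' g' p)⁻¹‖ = 0 := by
    simpa [hD, h2.2.ne'] using h1
  rw [norm_eq_zero, sub_eq_zero, map_inv₀] at h3
  exact inv_injective h3

theorem companion_differences {c : ℝ} {H : Measure (ℝ × ℝ)} {x : ℝ} {m g m' g' : ℂ}
    (h : SolvesCompanionSystem c H x m g) (h' : SolvesCompanionSystem c H x m' g') :
    Integrable (fun p : ℝ × ℝ => (p.1 * (g - g') + p.2 * (m - m')) / (den m g p * den m' g' p)) H ∧
    x * (m - m')
      = c * ∫ p : ℝ × ℝ, (p.1 * (g - g') + p.2 * (m - m')) / (den m g p * den m' g' p) ∂H ∧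
    Integrable (fun p : ℝ × ℝ =>
      p.2 * (p.1 * (g - g') + p.2 * (m - m')) / (den m g p * den m' g' p)) H ∧
    (g - g') / (g * g') = c * ∫ p : ℝ × ℝ,
      p.2 * (p.1 * (g - g') + p.2 * (m - m')) / (den m g p * den m' g' p) ∂H := by
  have e1 : (fun p : ℝ × ℝ => 1 / den m' g' p - 1 / den m g p) =ᵐ[H]
      fun p => (p.1 * (g - g') + p.2 * (m - m')) / (den m g p * den m' g' p) := by
    filter_upwards [h.denom_ne, h'.denom_ne] with p h1 h2
    change den m g p ≠ 0 at h1
    change den m' g' p ≠ 0 at h2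
    field_simp
    simp only [den]
    ring
  have e2 : (fun p : ℝ × ℝ => (p.2 : ℂ) / den m' g' p - (p.2 : ℂ) / den m g p) =ᵐ[H]
      fun p => p.2 * (p.1 * (g - g') + p.2 * (m - m')) / (den m g p * den m' g' p) := by
    filter_upwards [h.denom_ne, h'.denom_ne] with p h1 h2
    change den m g p ≠ 0 at h1
    change den m' g' p ≠ 0 at h2
    field_simp
    simp only [den]
    ring
  have a1 : (x : ℂ) * m = -(1 - (c : ℂ)) - (c : ℂ) * ∫ p, 1 / den m g p ∂H := h.eq_fst
  have a2 : (x : ℂ) * m' = -(1 - (c : ℂ)) - (c : ℂ) * ∫ p, 1 / den m' g' p ∂H := h'.eq_fst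
  have b1 : (x : ℂ) = -1 / g + c * ∫ p : ℝ × ℝ, (p.2 : ℂ) / den m g p ∂H := h.eq_snd
  have b2 : (x : ℂ) = -1 / g' + c * ∫ p : ℝ × ℝ, (p.2 : ℂ) / den m' g' p ∂H := h'.eq_snd
  refine ⟨(h'.integrable_fst.sub h.integrable_fst).congr e1, ?_,
    (h'.integrable_snd.sub h.integrable_snd).congr e2, ?_⟩
  · have := integral_sub h'.integrable_fst h.integrable_fst
    rw [← integral_congr_ae e1]
    change ∫ p, (1 / den m' g' p - 1 / den m g p) ∂H = ∫ p, 1 / den m' g' p ∂H - ∫ p, 1 / den m g p ∂H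
      at this
    rw [this]
    linear_combination a1 - a2
  · have := integral_sub h'.integrable_snd h.integrable_snd
    rw [← integral_congr_ae e2]
    change ∫ p : ℝ × ℝ, ((p.2 : ℂ) / den m' g' p - (p.2 : ℂ) / den m g p) ∂H
      = ∫ p : ℝ × ℝ, (p.2 : ℂ) / den m' g' p ∂H - ∫ p : ℝ × ℝ, (p.2 : ℂ) / den m g p ∂H at this
    rw [this]
    have hg : (g - g') / (g * g') = 1 / g' - 1 / g := by
      have := h.aux_ne
      have := h'.aux_ne
      field_simp
    rw [hg]
    linear_combination b2 - b1

/-- Valid for either sign of `x`; it identifies `g` once `m` is known, in particular on the negative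
axis. -/
theorem companion_aux_unique {c : ℝ} (hc : 0 < c) {H : Measure (ℝ × ℝ)}
    [IsProbabilityMeasure H] (hH : ∀ᵐ p ∂H, 0 ≤ p.1 ∧ 0 < p.2) {x : ℝ} {m g g' : ℂ}
    (hs : SolvesCompanionSystem c H x m g) (hs' : SolvesCompanionSystem c H x m g')
    (h : IsStableSol c H ‖(x : ℂ)‖ m g) (h' : IsStableSol c H ‖(x : ℂ)‖ m g') : g = g' := by
  obtain ⟨iA, hA, iB, hB⟩ := companion_differences hs hs'
  exact sub_eq_zero.1 <|
    (stable_pair_kernel hc hH hs.denom_ne hs'.denom_ne h h' iA hA iB hB).1 (sub_self m)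

/-- Different `m` would give `E = conj E'`; as both imaginary parts are nonnegative, both vanish and
`E = E'`. The first equation then gives `x m = x m'`. -/
theorem companion_unique {c : ℝ} (hc : 0 < c) {H : Measure (ℝ × ℝ)}
    [IsProbabilityMeasure H] (hH : ∀ᵐ p ∂H, 0 ≤ p.1 ∧ 0 < p.2) {x : ℝ} (hx : 0 < x)
    {m g m' g' : ℂ}
    (hs : SolvesCompanionSystem c H x m g) (hs' : SolvesCompanionSystem c H x m' g')
    (h : IsStableSol c H ‖(x : ℂ)‖ m g) (h' : IsStableSol c H ‖(x : ℂ)‖ m' g')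
    (hm : 0 ≤ m.im) (hm' : 0 ≤ m'.im) (hg : 0 ≤ g.im) (hg' : 0 ≤ g'.im) : m = m' := by
  obtain ⟨iA, hA, iB, hB⟩ := companion_differences hs hs'
  by_contra hne
  have h1 := (stable_pair_kernel hc hH hs.denom_ne hs'.denom_ne h h' iA hA iB hB).2 hx
    (sub_ne_zero.2 hne)
  have h2 : ∀ᵐ p ∂H, den m g p = den m' g' p := by
    filter_upwards [h1, hH] with p h1 h2
    have h3 := congrArg Complex.im h1
    rw [Complex.conj_im, den_im, den_im] at h3
    have a1 := mul_nonneg h2.1 hg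
    have a2 := mul_nonneg h2.1 hg'
    have a3 := mul_nonneg h2.2.le hm
    have a4 := mul_nonneg h2.2.le hm'
    refine Complex.ext ?_ ?_
    · rw [h1, Complex.conj_re]
    · rw [den_im, den_im]; linarith
  have a1 : (x : ℂ) * m = -(1 - (c : ℂ)) - (c : ℂ) * ∫ p, 1 / den m g p ∂H := hs.eq_fst
  have a2 : (x : ℂ) * m' = -(1 - (c : ℂ)) - (c : ℂ) * ∫ p, 1 / den m' g' p ∂H := hs'.eq_fst
  rw [integral_congr_ae (h2.mono fun p hp => by rw [hp])] at a1
  exact hne (mul_left_cancel₀ (Complex.ofReal_ne_zero.2 hx.ne') (a1.trans a2.symm))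

/-! ### Stieltjes transforms and the companion distribution -/

theorem ofReal_sub_ne_zero {z : ℂ} (hz : 0 < z.im) (l : ℝ) : (l : ℂ) - z ≠ 0 := by
  intro h
  have := congrArg Complex.im h
  simp at this
  exact hz.ne' this

theorem integrable_inv_ofReal_sub (μ : Measure ℝ) [IsFiniteMeasure μ] {z : ℂ} (hz : 0 < z.im) :
    Integrable (fun l : ℝ => ((l : ℂ) - z)⁻¹) μ := by
  refine Integrable.of_bound
    ((Complex.measurable_ofReal.sub_const z).inv.aestronglyMeasurable) z.im⁻¹ (ae_of_all _ fun l => ?_)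
  rw [norm_inv]
  refine inv_anti₀ hz ?_
  have := Complex.abs_im_le_norm ((l : ℂ) - z)
  simp only [Complex.sub_im, Complex.ofReal_im, zero_sub, abs_neg] at this
  exact (le_abs_self _).trans this

theorem inv_ofReal_sub_im (z : ℂ) (l : ℝ) :
    (((l : ℂ) - z)⁻¹).im = z.im / Complex.normSq ((l : ℂ) - z) := by
  rw [Complex.inv_im]; simp

theorem stieltjes_im (μ : Measure ℝ) [IsFiniteMeasure μ] {z : ℂ} (hz : 0 < z.im) :
    (stieltjes μ z).im = ∫ l : ℝ, z.im / Complex.normSq ((l : ℂ) - z) ∂μ := by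
  have := integral_im (integrable_inv_ofReal_sub μ hz)
  simp only [RCLike.im_eq_complex_im, inv_ofReal_sub_im] at this
  exact this.symm

theorem stieltjes_im_pos (μ : Measure ℝ) [IsProbabilityMeasure μ] {z : ℂ} (hz : 0 < z.im) :
    0 < (stieltjes μ z).im := by
  rw [stieltjes_im μ hz]
  have hpos : ∀ l : ℝ, 0 < z.im / Complex.normSq ((l : ℂ) - z) := fun l =>
    div_pos hz (Complex.normSq_pos.2 (ofReal_sub_ne_zero hz l))
  rw [integral_pos_iff_support_of_nonneg (fun l => (hpos l).le)]
  · have : (Function.support fun l : ℝ => z.im / Complex.normSq ((l : ℂ) - z)) = univ :=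
      eq_univ_of_forall fun l => (hpos l).ne'
    rw [this]; simp
  · have := (integrable_inv_ofReal_sub μ hz).im
    simpa only [RCLike.im_eq_complex_im, inv_ofReal_sub_im] using this

theorem mul_stieltjes_im_nonneg (μ : Measure ℝ) [IsFiniteMeasure μ] (hμ : μ (Iio 0) = 0) {z : ℂ}
    (hz : 0 < z.im) : 0 ≤ (z * stieltjes μ z).im := by
  have hi := (integrable_inv_ofReal_sub μ hz).const_mul z
  have := integral_im hi
  simp only [RCLike.im_eq_complex_im] at this
  rw [stieltjes, ← integral_const_mul, ← this]
  have h0 : ∀ᵐ l ∂μ, 0 ≤ l := by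
    rw [ae_iff]
    simpa [Iio, not_le] using hμ
  refine integral_nonneg_of_ae (h0.mono fun l hl => ?_)
  have h1 : z * ((l : ℂ) - z)⁻¹ = l * ((l : ℂ) - z)⁻¹ - 1 := by
    have := ofReal_sub_ne_zero hz l
    field_simp
    ring
  simp only [Pi.zero_apply]
  rw [h1, Complex.sub_im, Complex.im_ofReal_mul, inv_ofReal_sub_im, Complex.one_im, sub_zero]
  exact mul_nonneg hl (div_nonneg hz.le (Complex.normSq_nonneg _))

theorem continuousAt_stieltjes_of_neg (μ : Measure ℝ) [IsFiniteMeasure μ] (hμ : μ (Iio 0) = 0)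
    {x : ℝ} (hx : x < 0) : ContinuousAt (stieltjes μ) x := by
  have h0 : ∀ᵐ l ∂μ, 0 ≤ l := by
    rw [ae_iff]
    simpa [Iio, not_le] using hμ
  have hev : ∀ᶠ z : ℂ in 𝓝 (x : ℂ), z.re < x / 2 :=
    Complex.continuous_re.continuousAt.eventually_lt continuousAt_const (by simp; linarith)
  have hpos : 0 < -x / 2 := by linarith
  have hlow : ∀ z : ℂ, z.re < x / 2 → ∀ l : ℝ, 0 ≤ l → -x / 2 ≤ ‖(l : ℂ) - z‖ := by
    intro z hz l hl
    have := Complex.re_le_norm ((l : ℂ) - z)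
    simp only [Complex.sub_re, Complex.ofReal_re] at this
    linarith
  unfold stieltjes
  refine continuousAt_of_dominated (bound := fun _ => (-x / 2)⁻¹)
    (Eventually.of_forall fun z => (Complex.measurable_ofReal.sub_const z).inv.aestronglyMeasurable)
    ?_ (integrable_const _) ?_
  · filter_upwards [hev] with z hz
    filter_upwards [h0] with l hl
    rw [norm_inv]
    exact inv_anti₀ hpos (hlow z hz l hl)
  · filter_upwards [h0] with l hl
    refine (continuousAt_const.sub continuousAt_id).inv₀ ?_
    have h1 := hlow (x : ℂ) (by simp; linarith) l hl
    exact norm_pos_iff.1 (hpos.trans_le h1)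

section Companion

variable {c : ℝ} {F : Measure ℝ}

theorem isProbabilityMeasure_companionLSD (hc0 : 0 < c) (hc1 : c ≤ 1) [IsProbabilityMeasure F] :
    IsProbabilityMeasure (companionLSD c F) := by
  refine ⟨?_⟩
  simp only [companionLSD, Measure.add_apply, Measure.smul_apply, measure_univ, smul_eq_mul, mul_one]
  rw [← ENNReal.ofReal_add (by linarith) hc0.le]
  simp

theorem companionLSD_Iio (hF : F (Iio 0) = 0) : companionLSD c F (Iio 0) = 0 := by
  simp [companionLSD, hF]

theorem stieltjes_companionLSD (hc0 : 0 < c) (hc1 : c ≤ 1) [IsProbabilityMeasure F] {z : ℂ}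
    (hz : 0 < z.im) :
    stieltjes (companionLSD c F) z = -(1 - c) / z + c * stieltjes F z := by
  unfold stieltjes companionLSD
  rw [integral_add_measure ((integrable_inv_ofReal_sub _ hz).smul_measure ENNReal.ofReal_ne_top)
    ((integrable_inv_ofReal_sub _ hz).smul_measure ENNReal.ofReal_ne_top),
    integral_smul_measure, integral_smul_measure, integral_dirac,
    ENNReal.toReal_ofReal (by linarith), ENNReal.toReal_ofReal hc0.le]
  simp only [Complex.real_smul]
  push_cast
  rw [zero_sub, inv_neg]
  ring

end Companion

/-! ### Existence of the boundary limits -/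

/-- The basic properties of the companion solution at a point of the upper half plane. -/
theorem IsLSD.companion_solution {c : ℝ} (hc0 : 0 < c) (hc1 : c ≤ 1)
    {H : Measure (ℝ × ℝ)} [IsProbabilityMeasure H] (hH : ∀ᵐ p ∂H, 0 ≤ p.1 ∧ 0 < p.2)
    {F : Measure ℝ} {g : ℂ → ℂ} (hF : IsLSD c H F g) {z : ℂ} (hz : z ∈ upperHalf) :
    SolvesCompanionSystem c H z (stieltjes (companionLSD c F) z) (companionAux c g z) ∧
    IsStableSol c H ‖z‖ (stieltjes (companionLSD c F) z) (companionAux c g z) ∧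
    0 < (stieltjes (companionLSD c F) z).im ∧ 0 < (companionAux c g z).im := by
  have hz' : 0 < z.im := hz
  have := hF.isProbabilityMeasure
  have := isProbabilityMeasure_companionLSD (F := F) hc0 hc1
  have hz0 : z ≠ 0 := by rintro rfl; simp at hz'
  have hg := hF.im_pos z hz
  have h1cg : 1 + (c : ℂ) * g z ≠ 0 := by
    intro h
    have := congrArg Complex.im h
    rw [Complex.add_im, Complex.im_ofReal_mul] at this
    simp at this
    rcases this with h | h
    · exact hc0.ne' h
    · exact hg.ne' h
  obtain ⟨i1, i2, e1, e2⟩ := hF.solves z hz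
  have hM := stieltjes_companionLSD (F := F) hc0 hc1 hz'
  have hMpos := stieltjes_im_pos (companionLSD c F) hz'
  have hzm0 := mul_stieltjes_im_nonneg F hF.nonneg hz'
  have hzM := mul_stieltjes_im_nonneg (companionLSD c F) (companionLSD_Iio hF.nonneg) hz'
  set mo := stieltjes F z with hmo
  set M := stieltjes (companionLSD c F) z
  set G := companionAux c g z with hG
  have hGdef : G = -1 / (z * (1 + c * g z)) := rfl
  have hG0 : G ≠ 0 := by
    rw [hGdef]
    exact div_ne_zero (by norm_num) (mul_ne_zero hz0 h1cg)
  have hzG : z * G = ((-1 : ℝ) : ℂ) / (1 + c * g z) := by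
    rw [hGdef]; push_cast; field_simp
  have hzGim : 0 < (z * G).im := by
    rw [hzG, im_real_div, Complex.add_im, Complex.im_ofReal_mul, Complex.one_im]
    have := norm_pos_iff.2 h1cg
    have : 0 < c * (g z).im / ‖1 + (c : ℂ) * g z‖ ^ 2 := by positivity
    linarith [this, show -(-1 * (0 + c * (g z).im) / ‖1 + (c : ℂ) * g z‖ ^ 2)
      = c * (g z).im / ‖1 + (c : ℂ) * g z‖ ^ 2 by ring]
  -- This identity transports the original system to the companion one: both its integrals are those
  -- of the companion system up to the factor `-1/z`.
  have hD : ∀ p, lsdDenom c z mo (g z) p = -z * den M G p := by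
    intro p
    rw [lsdDenom, den, hM, hGdef]
    field_simp
    ring
  simp_rw [hD] at i1 i2 e1 e2
  have hden : ∀ᵐ p ∂H, den M G p ≠ 0 := by
    filter_upwards [hH] with p hp h0
    have h1 := mul_den_im z M G p
    rw [h0, mul_zero, Complex.zero_im] at h1
    have h2 := mul_nonneg hp.1 hzGim.le
    have h3 := mul_nonneg hp.2.le hzM
    linarith
  have k1 : ∀ p, 1 / den M G p = -z * (1 / (-z * den M G p)) := fun p => by
    field_simp
  have k2 : ∀ p : ℝ × ℝ, (p.2 : ℂ) / den M G p = -z * (p.2 / (-z * den M G p)) := fun p => by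
    field_simp
  have hsol : SolvesCompanionSystem c H z M G := by
    refine ⟨hden, ?_, ?_, hG0, ?_, ?_⟩
    · change Integrable (fun p => 1 / den M G p) H
      rw [funext k1]
      exact i1.const_mul _
    · change Integrable (fun p : ℝ × ℝ => (p.2 : ℂ) / den M G p) H
      rw [funext k2]
      exact i2.const_mul _
    · change z * M = -(1 - (c : ℂ)) - c * ∫ p, 1 / den M G p ∂H
      simp_rw [k1]
      rw [integral_const_mul, ← e1, hM]
      field_simp
      ring
    · change z = -1 / G + c * ∫ p : ℝ × ℝ, (p.2 : ℂ) / den M G p ∂H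
      simp_rw [k2]
      rw [integral_const_mul, ← e2, hGdef]
      field_simp
      ring
  obtain ⟨a1, a2⟩ := isStableSol_of_upperHalf hc0 hc1 hH hz' hsol hMpos hzM hzGim
  exact ⟨hsol, a2, hMpos, a1⟩

/-- By the arithmetic-geometric mean, `1/|E| ≤ (t⁻¹ + t/|E|²) / 2` and `t/|E| ≤ (t + t/|E|²) / 2`,
while the moment `c ∫ t/|E|²` is at most `|z|`. -/
theorem companion_bounds {c : ℝ} (hc0 : 0 < c) (hc1 : c ≤ 1) {H : Measure (ℝ × ℝ)}
    (hH : ∀ᵐ p ∂H, 0 ≤ p.1 ∧ 0 < p.2) (ht : Integrable (fun p : ℝ × ℝ => p.2) H)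
    (hti : Integrable (fun p : ℝ × ℝ => p.2⁻¹) H) {z m g : ℂ}
    (hS : SolvesCompanionSystem c H z m g) (hst : IsStableSol c H ‖z‖ m g) :
    ‖z‖ * ‖m‖ ≤ (1 - c) + (c * ∫ p, p.2⁻¹ ∂H + ‖z‖) / 2 ∧
    ‖g⁻¹‖ ≤ ‖z‖ + (c * ∫ p, p.2 ∂H + ‖z‖) / 2 := by
  obtain ⟨β, r, -, hr, -, h, -⟩ := hst
  obtain ⟨hi, hle⟩ := integral_le_of_quad_le hc0 measurable_snd (hH.mono fun p hp => hp.2.le)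
    (norm_nonneg _) (le_self_add.trans h)
  have key : ∀ {k : ℝ × ℝ → ℝ} {f : ℝ × ℝ → ℂ}, Integrable k H → Integrable f H →
      (∀ᵐ p ∂H, ‖f p‖ ≤ (k p + p.2 / ‖den m g p‖ ^ 2) / 2) →
      ‖(c : ℂ) * ∫ p, f p ∂H‖ ≤ (c * ∫ p, k p ∂H + ‖z‖) / 2 := by
    intro k f hk hf hb
    have h1 : ‖∫ p, f p ∂H‖ ≤ (∫ p, k p ∂H + ∫ p, p.2 / ‖den m g p‖ ^ 2 ∂H) / 2 := by
      rw [← integral_add hk hi, ← integral_div]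
      exact (norm_integral_le_integral_norm _).trans
        (integral_mono_ae hf.norm ((hk.add hi).div_const 2) hb)
    rw [norm_mul, Complex.norm_real, Real.norm_of_nonneg hc0.le]
    calc c * ‖∫ p, f p ∂H‖ ≤ c * ((∫ p, k p ∂H + ∫ p, p.2 / ‖den m g p‖ ^ 2 ∂H) / 2) := by gcongr
      _ = (c * ∫ p, k p ∂H + c * ∫ p, p.2 / ‖den m g p‖ ^ 2 ∂H) / 2 := by ring
      _ ≤ _ := by gcongr
  have hA : z * m = -(1 - (c : ℂ)) - c * ∫ p, 1 / den m g p ∂H := hS.eq_fst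
  have hB : z = -1 / g + c * ∫ p : ℝ × ℝ, (p.2 : ℂ) / den m g p ∂H := hS.eq_snd
  constructor
  · have h1 := key hti hS.integrable_fst (hH.mono fun p hp => by
      have h2 := hp.2
      change ‖1 / den m g p‖ ≤ _
      rw [norm_div, norm_one, div_eq_mul_inv, div_eq_mul_inv p.2, one_mul, ← inv_pow]
      generalize ‖den m g p‖⁻¹ = A
      have h3 : p.2⁻¹ + p.2 * A ^ 2 - 2 * A = p.2⁻¹ * (1 - p.2 * A) ^ 2 := by
        field_simp; ring
      have : 0 ≤ p.2⁻¹ * (1 - p.2 * A) ^ 2 := by positivity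
      linarith)
    change ‖(c : ℂ) * ∫ p, 1 / den m g p ∂H‖ ≤ _ at h1
    rw [← norm_mul, hA]
    refine (norm_sub_le _ _).trans (add_le_add (le_of_eq ?_) h1)
    rw [norm_neg, ← Complex.ofReal_one, ← Complex.ofReal_sub, Complex.norm_real,
      Real.norm_of_nonneg (by linarith)]
  · have h1 := key ht hS.integrable_snd (hH.mono fun p hp => by
      have h2 := hp.2
      change ‖(p.2 : ℂ) / den m g p‖ ≤ _
      rw [norm_div, Complex.norm_real, Real.norm_of_nonneg h2.le, div_eq_mul_inv,
        div_eq_mul_inv p.2, ← inv_pow]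
      generalize ‖den m g p‖⁻¹ = A
      nlinarith [mul_nonneg h2.le (sq_nonneg (1 - A))])
    change ‖(c : ℂ) * ∫ p : ℝ × ℝ, (p.2 : ℂ) / den m g p ∂H‖ ≤ _ at h1
    have h2 : g⁻¹ = (c * ∫ p : ℝ × ℝ, (p.2 : ℂ) / den m g p ∂H) - z := by
      conv_rhs => rw [hB]
      ring
    rw [h2]
    refine (norm_sub_le _ _).trans ?_
    linarith

theorem mem_closure_upperHalf (x : ℝ) : (x : ℂ) ∈ closure upperHalf := by
  have : upperHalf = {z : ℂ | 0 < z.im} := rfl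
  rw [this, Complex.closure_setOfPred_lt_im]
  simp

/-- Near `x` the pair `(m, 1/g)` stays in a compact set, so it converges as soon as its cluster
point is unique. Using `1/g` avoids the need for an upper bound on `g`. -/
theorem IsLSD.exists_boundary_limit {c : ℝ} (hc0 : 0 < c) (hc1 : c ≤ 1)
    {H : Measure (ℝ × ℝ)} [IsProbabilityMeasure H] (hH : ∀ᵐ p ∂H, 0 ≤ p.1 ∧ 0 < p.2)
    (ht : Integrable (fun p : ℝ × ℝ => p.2) H) (hti : Integrable (fun p : ℝ × ℝ => p.2⁻¹) H)
    {F : Measure ℝ} {g : ℂ → ℂ} (hF : IsLSD c H F g) {x : ℝ} (hx : x ≠ 0) :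
    ∃ m₀ g₀ : ℂ,
      Tendsto (stieltjes (companionLSD c F)) (𝓝[upperHalf] (x : ℂ)) (𝓝 m₀) ∧
      Tendsto (companionAux c g) (𝓝[upperHalf] (x : ℂ)) (𝓝 g₀) ∧
      SolvesCompanionSystem c H x m₀ g₀ ∧ IsStableSol c H ‖(x : ℂ)‖ m₀ g₀ ∧
      0 ≤ m₀.im ∧ 0 ≤ g₀.im := by
  have := hF.isProbabilityMeasure
  have := isProbabilityMeasure_companionLSD (F := F) hc0 hc1
  set M := stieltjes (companionLSD c F) with hM
  set G := companionAux c g with hG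
  have hsol := fun {z : ℂ} (hz : z ∈ upperHalf) => hF.companion_solution hc0 hc1 hH hz
  rw [← hM, ← hG] at hsol
  have hxc : (x : ℂ) ≠ 0 := Complex.ofReal_ne_zero.2 hx
  set l := 𝓝[upperHalf] (x : ℂ) with hl
  have : l.NeBot := mem_closure_iff_nhdsWithin_neBot.1 (mem_closure_upperHalf x)
  have hup : ∀ᶠ z in l, z ∈ upperHalf := self_mem_nhdsWithin
  have hlx : Tendsto (fun z : ℂ => z) l (𝓝 (x : ℂ)) := tendsto_id.mono_left nhdsWithin_le_nhds
  -- the properties of a cluster point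
  have cluster : ∀ y : ℂ × ℂ, MapClusterPt y l (fun z => (M z, (G z)⁻¹)) →
      (x < 0 → Tendsto M l (𝓝 y.1)) ∧ y.2 ≠ 0 ∧ SolvesCompanionSystem c H x y.1 y.2⁻¹ ∧
        IsStableSol c H ‖(x : ℂ)‖ y.1 y.2⁻¹ ∧ 0 ≤ y.1.im ∧ 0 ≤ (y.2⁻¹).im := by
    intro y hy
    obtain ⟨ψ₀, hψ₁, hψ₂⟩ := hy.exists_seq_tendsto
    obtain ⟨N, hN⟩ := eventually_atTop.1 (hψ₂.eventually hup)
    set ψ : ℕ → ℂ := fun n => ψ₀ (n + N) with hψ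
    have hψu : ∀ n, ψ n ∈ upperHalf := fun n => hN _ (Nat.le_add_left _ _)
    have hψl : Tendsto ψ atTop l := hψ₂.comp (tendsto_add_atTop_nat N)
    have hψy := hψ₁.comp (tendsto_add_atTop_nat N)
    have t1 : Tendsto (fun n => M (ψ n)) atTop (𝓝 y.1) := (continuous_fst.tendsto y).comp hψy
    have t2 : Tendsto (fun n => (G (ψ n))⁻¹) atTop (𝓝 y.2) := (continuous_snd.tendsto y).comp hψy
    have hz := hlx.comp hψl
    have hy2 : y.2 ≠ 0 := by
      intro h0
      rw [h0] at t2
      exact not_tendsto_inv_zero hc0 hc1 hH ht hti (fun n => (hsol (hψu n)).1)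
        (fun n => (hsol (hψu n)).2.1) hz hxc t1 t2
    have t3 : Tendsto (fun n => G (ψ n)) atTop (𝓝 y.2⁻¹) := by
      simpa using t2.inv₀ hy2
    obtain ⟨s1, s2⟩ := limit_stable hc0 hH ht hti (fun n => (hsol (hψu n)).1)
        (fun n => (hsol (hψu n)).2.1) hz t1 t3 (inv_ne_zero hy2)
    refine ⟨fun hneg => ?_, hy2, s1, s2, ?_, ?_⟩
    · have h1 : Tendsto M l (𝓝 (M x)) :=
        (continuousAt_stieltjes_of_neg _ (companionLSD_Iio hF.nonneg) hneg).tendsto.comp hlx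
      have h2 := tendsto_nhds_unique t1 (h1.comp hψl)
      rwa [h2]
    · exact ge_of_tendsto' ((Complex.continuous_im.tendsto _).comp t1)
        fun n => (hsol (hψu n)).2.2.1.le
    · exact ge_of_tendsto' ((Complex.continuous_im.tendsto _).comp t3)
        fun n => (hsol (hψu n)).2.2.2.le
  have unique : ∀ y y' : ℂ × ℂ, MapClusterPt y l (fun z => (M z, (G z)⁻¹)) →
      MapClusterPt y' l (fun z => (M z, (G z)⁻¹)) → y = y' := by
    intro y y' hy hy'
    obtain ⟨a1, a2, a3, a4, a5, a6⟩ := cluster y hy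
    obtain ⟨b1, b2, b3, b4, b5, b6⟩ := cluster y' hy'
    have h1 : y.1 = y'.1 := by
      rcases lt_or_gt_of_ne hx with h | h
      · exact tendsto_nhds_unique (a1 h) (b1 h)
      · exact companion_unique hc0 hH h a3 b3 a4 b4 a5 b5 a6 b6
    rw [h1] at a3 a4
    have h2 := companion_aux_unique hc0 hH a3 b3 a4 b4
    exact Prod.ext h1 (inv_injective h2)
  -- compactness
  set C₁ := ((1 - c) + (c * ∫ p, p.2⁻¹ ∂H + 2 * |x|) / 2) / (|x| / 2) with hC₁
  set C₂ := 2 * |x| + (c * ∫ p, p.2 ∂H + 2 * |x|) / 2 with hC₂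
  have hxa : 0 < |x| := abs_pos.2 hx
  have hnx : Tendsto (fun z : ℂ => ‖z‖) l (𝓝 |x|) := by
    simpa using hlx.norm
  have hK : ∀ᶠ z in l, (M z, (G z)⁻¹) ∈ Metric.closedBall (0 : ℂ) C₁ ×ˢ Metric.closedBall (0 : ℂ) C₂ := by
    filter_upwards [hup, hnx.eventually_lt_const (show |x| < 2 * |x| by linarith),
      hnx.eventually_const_lt (show |x| / 2 < |x| by linarith)] with z hz h1 h2
    obtain ⟨h3, h4⟩ := companion_bounds hc0 hc1 hH ht hti (hsol hz).1 (hsol hz).2.1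
    simp only [mem_prod, mem_closedBall_zero_iff]
    refine ⟨?_, h4.trans ?_⟩
    · rw [hC₁, le_div_iff₀ (by positivity)]
      have := mul_le_mul_of_nonneg_right h2.le (norm_nonneg (M z))
      linarith
    · rw [hC₂]; linarith
  have hKc := (isCompact_closedBall (0 : ℂ) C₁).prod (isCompact_closedBall (0 : ℂ) C₂)
  obtain ⟨y, -, hy⟩ := hKc.exists_mapClusterPt_of_frequently hK.frequently
  obtain ⟨-, a2, a3, a4, a5, a6⟩ := cluster y hy
  have hlim := hKc.tendsto_nhds_of_unique_mapClusterPt hK fun y' _ hy' => unique y' y hy' hy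
  refine ⟨y.1, y.2⁻¹, (continuous_fst.tendsto y).comp hlim, ?_, a3, a4, a5, a6⟩
  have := ((continuous_snd.tendsto y).comp hlim).inv₀ a2
  simpa [Function.comp_def] using this

/-! ### Stieltjes inversion and the density -/

theorem hasDerivAt_arctan_sub_div {ε : ℝ} (hε : 0 < ε) (l x : ℝ) :
    HasDerivAt (fun x => Real.arctan ((x - l) / ε)) (ε / Complex.normSq ((l : ℂ) - (x + ε * Complex.I)))
      x := by
  have h1 : HasDerivAt (fun x : ℝ => (x - l) / ε) (1 / ε) x :=
    ((hasDerivAt_id x).sub_const l).div_const ε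
  refine h1.arctan.congr_deriv ?_
  have h2 : Complex.normSq ((l : ℂ) - (x + ε * Complex.I)) = (x - l) ^ 2 + ε ^ 2 := by
    rw [Complex.normSq_apply]; simp; ring
  rw [h2]
  have : (x - l) ^ 2 + ε ^ 2 ≠ 0 := by positivity
  field_simp
  rw [add_comm]

theorem integrable_poisson_prod (μ : Measure ℝ) [IsFiniteMeasure μ] {a b ε : ℝ} (hε : 0 < ε) :
    Integrable (Function.uncurry fun x l : ℝ => ε / Complex.normSq ((l : ℂ) - (x + ε * Complex.I)))
      ((volume.restrict (Ioc a b)).prod μ) := by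
  have h2 : ∀ x l : ℝ, Complex.normSq ((l : ℂ) - (x + ε * Complex.I)) = (x - l) ^ 2 + ε ^ 2 := by
    intro x l
    rw [Complex.normSq_apply]; simp; ring
  simp_rw [h2]
  have hne : ∀ x l : ℝ, (x - l) ^ 2 + ε ^ 2 ≠ 0 := fun x l => by positivity
  refine Integrable.of_bound (Continuous.aestronglyMeasurable ?_) ε⁻¹ (ae_of_all _ fun p => ?_)
  · exact continuous_const.div (by fun_prop) fun p => hne p.1 p.2
  · simp only [Function.uncurry]
    rw [Real.norm_of_nonneg (by positivity), div_le_iff₀ (by positivity)]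
    have : ε⁻¹ * ((p.1 - p.2) ^ 2 + ε ^ 2) = ε + ε⁻¹ * (p.1 - p.2) ^ 2 := by field_simp; ring
    rw [this]
    have : 0 ≤ ε⁻¹ * (p.1 - p.2) ^ 2 := by positivity
    linarith

theorem stieltjes_im_add_mul_I (μ : Measure ℝ) [IsFiniteMeasure μ] {ε : ℝ} (hε : 0 < ε) (x : ℝ) :
    (stieltjes μ (x + ε * Complex.I)).im
      = ∫ l : ℝ, ε / Complex.normSq ((l : ℂ) - (x + ε * Complex.I)) ∂μ := by
  have h1 : ((x : ℂ) + ε * Complex.I).im = ε := by simp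
  have := stieltjes_im μ (z := x + ε * Complex.I) (by rw [h1]; exact hε)
  rwa [h1] at this

/-- Fubini, since `Im m(x + iε)` is the integral of the Poisson kernel, whose primitive is an
arctangent. -/
theorem integral_stieltjes_im (μ : Measure ℝ) [IsFiniteMeasure μ] {a b ε : ℝ} (hab : a ≤ b)
    (hε : 0 < ε) :
    ∫ x in Ioc a b, (stieltjes μ (x + ε * Complex.I)).im
      = ∫ l, (Real.arctan ((b - l) / ε) - Real.arctan ((a - l) / ε)) ∂μ := by
  simp_rw [stieltjes_im_add_mul_I μ hε]
  rw [integral_integral_swap (integrable_poisson_prod μ hε)]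
  refine integral_congr_ae (ae_of_all _ fun l => ?_)
  simp only
  rw [← intervalIntegral.integral_of_le hab,
    intervalIntegral.integral_eq_sub_of_hasDerivAt (fun x _ => hasDerivAt_arctan_sub_div hε l x)]
  have h2 : ∀ x : ℝ, Complex.normSq ((l : ℂ) - (x + ε * Complex.I)) = (x - l) ^ 2 + ε ^ 2 := by
    intro x
    rw [Complex.normSq_apply]; simp; ring
  simp_rw [h2]
  exact (continuous_const.div (by fun_prop) fun x => by positivity).intervalIntegrable _ _

theorem tendsto_arctan_div {ε : ℕ → ℝ} (hε : Tendsto ε atTop (𝓝[>] 0)) (y : ℝ) :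
    Tendsto (fun n => Real.arctan (y / ε n)) atTop (𝓝 (SignType.sign y * (Real.pi / 2))) := by
  have hinv : Tendsto (fun n => (ε n)⁻¹) atTop atTop := tendsto_inv_nhdsGT_zero.comp hε
  rcases lt_trichotomy y 0 with h | h | h
  · rw [sign_neg h]
    have : Tendsto (fun n => y / ε n) atTop atBot := hinv.const_mul_atTop_of_neg h
    simpa [Function.comp_def] using (Real.tendsto_arctan_atBot.mono_right nhdsWithin_le_nhds).comp this
  · simp [h]
  · rw [sign_pos h]
    have : Tendsto (fun n => y / ε n) atTop atTop := hinv.const_mul_atTop h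
    simpa [Function.comp_def] using (Real.tendsto_arctan_atTop.mono_right nhdsWithin_le_nhds).comp this

/-- A function on the upper half plane with finite boundary limits along a segment is bounded
near that segment. -/
theorem exists_bound_near_segment {φ : ℂ → ℝ} {h : ℝ → ℝ} {a b : ℝ}
    (hφ : ∀ x ∈ Icc a b, Tendsto φ (𝓝[upperHalf] (x : ℂ)) (𝓝 (h x))) :
    ∃ C δ : ℝ, 0 < δ ∧ ∀ x ∈ Icc a b, ∀ ε : ℝ, 0 < ε → ε < δ → |φ (x + ε * Complex.I)| ≤ C := by
  set K : Set ℂ := (fun x : ℝ => (x : ℂ)) '' Icc a b with hK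
  have hKc : IsCompact K := isCompact_Icc.image Complex.continuous_ofReal
  have hloc : ∃ C : ℝ, ∃ V : Set ℂ, IsOpen V ∧ K ⊆ V ∧ ∀ z ∈ V ∩ upperHalf, |φ z| ≤ C := by
    refine hKc.induction_on (p := fun s => ∃ C : ℝ, ∃ V : Set ℂ, IsOpen V ∧ s ⊆ V ∧
      ∀ z ∈ V ∩ upperHalf, |φ z| ≤ C) ⟨0, ∅, isOpen_empty, empty_subset _, by simp⟩ ?_ ?_ ?_
    · rintro s t hst ⟨C, V, h1, h2, h3⟩
      exact ⟨C, V, h1, hst.trans h2, h3⟩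
    · rintro s t ⟨C, V, h1, h2, h3⟩ ⟨C', V', h1', h2', h3'⟩
      refine ⟨max C C', V ∪ V', h1.union h1', union_subset_union h2 h2', ?_⟩
      rintro z ⟨hz | hz, hu⟩
      · exact (h3 z ⟨hz, hu⟩).trans (le_max_left _ _)
      · exact (h3' z ⟨hz, hu⟩).trans (le_max_right _ _)
    · rintro _ ⟨x, hx, rfl⟩
      have h1 : ∀ᶠ z in 𝓝[upperHalf] (x : ℂ), |φ z| < |h x| + 1 :=
        (hφ x hx).abs.eventually_lt_const (by linarith)
      obtain ⟨V, hV, hxV, hV2⟩ := mem_nhdsWithin.1 h1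
      exact ⟨V, mem_nhdsWithin_of_mem_nhds (hV.mem_nhds hxV), |h x| + 1, V, hV, Subset.rfl,
        fun z hz => (hV2 hz).le⟩
  obtain ⟨C, V, hV, hKV, hC⟩ := hloc
  obtain ⟨δ, hδ, hth⟩ := hKc.exists_thickening_subset_open hV hKV
  refine ⟨C, δ, hδ, fun x hx ε hε hεδ => hC _ ⟨hth ?_, ?_⟩⟩
  · rw [Metric.mem_thickening_iff]
    exact ⟨x, ⟨x, hx, rfl⟩, by simpa [dist_eq_norm, abs_of_pos hε] using hεδ⟩
  · show 0 < Complex.im _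
    simpa using hε

/-- **Stieltjes inversion formula** on a segment with finite boundary values. -/
theorem stieltjes_inversion (μ : Measure ℝ) [IsFiniteMeasure μ] {h : ℝ → ℝ} {a b : ℝ} (hab : a < b)
    (hlim : ∀ x ∈ Icc a b,
      Tendsto (fun z => (stieltjes μ z).im) (𝓝[upperHalf] (x : ℂ)) (𝓝 (h x))) :
    μ.real (Ioo a b) + (μ.real {a} + μ.real {b}) / 2 = ∫ x in a..b, h x / Real.pi := by
  obtain ⟨C, δ, hδ, hC⟩ := exists_bound_near_segment hlim
  obtain ⟨N, hN⟩ := exists_nat_one_div_lt hδ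
  set ε : ℕ → ℝ := fun n => 1 / ((n + N : ℕ) + 1 : ℝ) with hε
  have hε0 : ∀ n, 0 < ε n := fun n => by simp only [hε]; positivity
  have hεδ : ∀ n, ε n < δ := fun n => by
    refine lt_of_le_of_lt ?_ hN
    simp only [hε]
    gcongr
    simp
  have hεt0 : Tendsto ε atTop (𝓝 0) :=
    (tendsto_one_div_add_atTop_nhds_zero_nat (𝕜 := ℝ)).comp (tendsto_add_atTop_nat N)
  have hεt : Tendsto ε atTop (𝓝[>] 0) :=
    tendsto_nhdsWithin_iff.2 ⟨hεt0, Eventually.of_forall hε0⟩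
  have hL : Tendsto (fun n => ∫ x in Ioc a b, (stieltjes μ (x + ε n * Complex.I)).im) atTop
      (𝓝 (∫ x in Ioc a b, h x)) := by
    refine tendsto_integral_of_dominated_convergence (fun _ => C) (fun n => ?_)
      (integrable_const _) (fun n => ?_) ?_
    · simp_rw [stieltjes_im_add_mul_I μ (hε0 n)]
      exact (integrable_poisson_prod μ (hε0 n)).integral_prod_left.1
    · filter_upwards [ae_restrict_mem measurableSet_Ioc] with x hx
      exact hC x (Ioc_subset_Icc_self hx) _ (hε0 n) (hεδ n)
    · filter_upwards [ae_restrict_mem measurableSet_Ioc] with x hx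
      refine (hlim x (Ioc_subset_Icc_self hx)).comp (tendsto_nhdsWithin_iff.2 ⟨?_, ?_⟩)
      · have : Tendsto (fun n => (x : ℂ) + (ε n : ℂ) * Complex.I) atTop
            (𝓝 ((x : ℂ) + ((0 : ℝ) : ℂ) * Complex.I)) :=
          tendsto_const_nhds.add
            (((Complex.continuous_ofReal.tendsto 0).comp hεt0).mul_const Complex.I)
        simpa using this
      · refine Eventually.of_forall fun n => ?_
        show 0 < Complex.im _
        simpa using hε0 n
  have hR : Tendsto (fun n => ∫ l, (Real.arctan ((b - l) / ε n) - Real.arctan ((a - l) / ε n)) ∂μ)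
      atTop (𝓝 (∫ l, (SignType.sign (b - l) * (Real.pi / 2)
        - SignType.sign (a - l) * (Real.pi / 2)) ∂μ)) := by
    refine tendsto_integral_of_dominated_convergence (fun _ => Real.pi) (fun n => ?_)
      (integrable_const _) (fun n => ae_of_all _ fun l => ?_) (ae_of_all _ fun l => ?_)
    · refine Continuous.aestronglyMeasurable ?_
      have := (hε0 n).ne'
      fun_prop
    · rw [Real.norm_eq_abs, abs_le]
      have h1 := Real.arctan_lt_pi_div_two ((b - l) / ε n)
      have h2 := Real.arctan_lt_pi_div_two ((a - l) / ε n)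
      have h3 := Real.neg_pi_div_two_lt_arctan ((b - l) / ε n)
      have h4 := Real.neg_pi_div_two_lt_arctan ((a - l) / ε n)
      constructor <;> linarith
    · exact (tendsto_arctan_div hεt _).sub (tendsto_arctan_div hεt _)
  have hEq := tendsto_nhds_unique hL (hR.congr fun n => (integral_stieltjes_im μ hab.le (hε0 n)).symm)
  -- Endpoint atoms get half weight because `SignType.sign 0 = 0`.
  have hind : (fun l : ℝ => (SignType.sign (b - l) : ℝ) * (Real.pi / 2)
      - SignType.sign (a - l) * (Real.pi / 2))
      = fun l => Real.pi * (Ioo a b).indicator (fun _ => (1 : ℝ)) l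
        + Real.pi / 2 * ({a} : Set ℝ).indicator (fun _ => (1 : ℝ)) l
        + Real.pi / 2 * ({b} : Set ℝ).indicator (fun _ => (1 : ℝ)) l := by
    funext l
    rcases lt_trichotomy l a with h1 | h1 | h1
    · have h2 : l < b := h1.trans hab
      rw [sign_pos (sub_pos.2 h1), sign_pos (sub_pos.2 h2)]
      simp [indicator, h1.not_gt, h1.ne, h2.ne]
    · subst h1
      rw [sign_pos (sub_pos.2 hab)]
      simp [indicator, hab.ne]
    · rw [sign_neg (sub_neg.2 h1)]
      rcases lt_trichotomy l b with h2 | h2 | h2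
      · rw [sign_pos (sub_pos.2 h2)]
        simp [indicator, h1, h2, h1.ne', h2.ne]
      · subst h2
        simp [indicator, h1.ne']
      · rw [sign_neg (sub_neg.2 h2)]
        simp [indicator, h2.not_gt, h1.ne', h2.ne']
  rw [hind, integral_linear_comb₃ ((integrable_const 1).indicator measurableSet_Ioo)
    ((integrable_const 1).indicator (measurableSet_singleton a))
    ((integrable_const 1).indicator (measurableSet_singleton b)),
    integral_indicator_const _ measurableSet_Ioo,
    integral_indicator_const _ (measurableSet_singleton a),
    integral_indicator_const _ (measurableSet_singleton b)] at hEq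
  rw [intervalIntegral.integral_div, intervalIntegral.integral_of_le hab.le, hEq]
  have := Real.pi_pos
  simp only [smul_eq_mul, mul_one]
  field_simp
  ring

/-- An atom at `x` would contribute at least half its mass to every short interval starting at `x`,
while the integral of the locally bounded density is of the order of the length. -/
theorem measureReal_Ioc_eq_integral (μ : Measure ℝ) [IsFiniteMeasure μ] {h : ℝ → ℝ} {U : Set ℝ}
    (hU : IsOpen U) (hc : ContinuousOn h U)
    (hlim : ∀ x ∈ U, Tendsto (fun z => (stieltjes μ z).im) (𝓝[upperHalf] (x : ℂ)) (𝓝 (h x)))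
    {a b : ℝ} (hab : a < b) (hI : Icc a b ⊆ U) :
    μ.real (Ioc a b) = ∫ x in a..b, h x / Real.pi := by
  have atom : ∀ x ∈ U, μ.real {x} = 0 := by
    intro x hx
    have h1 : ∀ᶠ y in 𝓝 x, y ∈ U ∧ |h y| < |h x| + 1 :=
      (hU.eventually_mem hx).and ((hc.continuousAt (hU.mem_nhds hx)).abs.eventually_lt_const (by linarith))
    obtain ⟨δ, hδ, hball⟩ := Metric.eventually_nhds_iff.1 h1
    by_contra hne
    have hpos : 0 < μ.real {x} := lt_of_le_of_ne measureReal_nonneg (Ne.symm hne)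
    set C := (|h x| + 1) / Real.pi with hC
    have hC0 : 0 < C := by have := Real.pi_pos; positivity
    -- The second bound makes the integral over `[x, x + η]` at most a quarter of the atom, against
    -- the half required by inversion.
    set η := min (δ / 2) (μ.real {x} / (4 * C)) with hη
    have hη0 : 0 < η := by positivity
    have hmem : ∀ y ∈ Icc x (x + η), y ∈ U ∧ |h y| < |h x| + 1 := by
      intro y hy
      refine hball ?_
      rw [Real.dist_eq, abs_of_nonneg (by linarith [hy.1])]
      linarith [hy.2, min_le_left (δ / 2) (μ.real {x} / (4 * C))]
    have h2 := stieltjes_inversion μ (show x < x + η by linarith)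
      fun y hy => hlim y (hmem y hy).1
    have h3 : ‖∫ y in x..(x + η), h y / Real.pi‖ ≤ C * |x + η - x| := by
      refine intervalIntegral.norm_integral_le_of_norm_le_const fun y hy => ?_
      rw [uIoc_of_le (by linarith)] at hy
      rw [norm_div, Real.norm_eq_abs, Real.norm_of_nonneg Real.pi_pos.le, hC]
      have := (hmem y (Ioc_subset_Icc_self hy)).2.le
      have := Real.pi_pos
      gcongr
    rw [add_sub_cancel_left, abs_of_pos hη0, ← h2] at h3
    have h4 := (le_abs_self _).trans h3
    have h5 : C * η ≤ μ.real {x} / 4 := by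
      have : η ≤ μ.real {x} / (4 * C) := min_le_right _ _
      rw [le_div_iff₀ (by positivity)] at this
      linarith
    have h6 : 0 ≤ μ.real (Ioo x (x + η)) := measureReal_nonneg
    have h7 : 0 ≤ μ.real {x + η} := measureReal_nonneg
    linarith
  have h1 := stieltjes_inversion μ hab fun x hx => hlim x (hI hx)
  rw [atom a (hI (left_mem_Icc.2 hab.le)), atom b (hI (right_mem_Icc.2 hab.le))] at h1
  rw [← Ioo_union_right hab, measureReal_union (by simp) (measurableSet_singleton b),
    atom b (hI (right_mem_Icc.2 hab.le)), ← h1]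
  ring

theorem hasDerivAt_measureReal_Iic (μ : Measure ℝ) [IsFiniteMeasure μ] {h : ℝ → ℝ} {U : Set ℝ}
    (hU : IsOpen U) (hc : ContinuousOn h U)
    (hlim : ∀ x ∈ U, Tendsto (fun z => (stieltjes μ z).im) (𝓝[upperHalf] (x : ℂ)) (𝓝 (h x)))
    {x : ℝ} (hx : x ∈ U) :
    HasDerivAt (fun y : ℝ => μ.real (Iic y)) (h x / Real.pi) x := by
  obtain ⟨δ, hδ, hball⟩ := Metric.isOpen_iff.1 hU x hx
  rw [Real.ball_eq_Ioo] at hball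
  set a := x - δ / 2 with ha
  have hI : ∀ y ∈ Ioo a (x + δ), Icc a y ⊆ U := fun y hy w hw =>
    hball ⟨by linarith [hw.1], by linarith [hw.2, hy.2]⟩
  have hcd : ContinuousOn (fun y => h y / Real.pi) U := hc.div_const _
  have h1 : HasDerivAt (fun y => μ.real (Iic a) + ∫ w in a..y, h w / Real.pi) (h x / Real.pi) x := by
    refine (intervalIntegral.integral_hasDerivAt_right ?_
      (hcd.stronglyMeasurableAtFilter hU x hx) (hcd.continuousAt (hU.mem_nhds hx))).const_add _
    refine ContinuousOn.intervalIntegrable (hcd.mono ?_)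
    rw [uIcc_of_le (by linarith)]
    exact hI x ⟨by linarith, by linarith⟩
  refine h1.congr_of_eventuallyEq ?_
  filter_upwards [Ioo_mem_nhds (show a < x by linarith) (show x < x + δ by linarith)] with y hy
  rw [← measureReal_Ioc_eq_integral μ hU hc hlim hy.1 (hI y hy),
    ← measureReal_union (by
      rw [disjoint_left]; intro w hw hw'; exact not_lt.2 hw hw'.1) measurableSet_Ioc,
    Iic_union_Ioc_eq_Iic hy.1.le]

/-- Countably many rational half-open intervals with closure in `U` cover `U`, and on each of them
the two measures agree on all subintervals `Ioc`. -/
theorem restrict_eq_withDensity_of_stieltjes (μ : Measure ℝ) [IsFiniteMeasure μ] {h : ℝ → ℝ}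
    {U : Set ℝ} (hU : IsOpen U) (hc : ContinuousOn h U) (h0 : ∀ x ∈ U, 0 ≤ h x)
    (hlim : ∀ x ∈ U, Tendsto (fun z => (stieltjes μ z).im) (𝓝[upperHalf] (x : ℂ)) (𝓝 (h x))) :
    μ.restrict U
      = (volume.restrict U).withDensity (fun x => ENNReal.ofReal (h x / Real.pi)) := by
  set ν := (volume : Measure ℝ).withDensity (fun x => ENNReal.ofReal (h x / Real.pi)) with hν
  rw [← restrict_withDensity hU.measurableSet]
  have hIoc : ∀ a b : ℝ, a < b → Icc a b ⊆ U → μ (Ioc a b) = ν (Ioc a b) := by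
    intro a b hab hI
    have hi : IntegrableOn (fun x => h x / Real.pi) (Ioc a b) :=
      (((hc.div_const _).mono hI).integrableOn_Icc).mono_set Ioc_subset_Icc_self
    rw [hν, withDensity_apply _ measurableSet_Ioc, ← ofReal_integral_eq_lintegral_ofReal hi,
      ← intervalIntegral.integral_of_le hab.le, ← measureReal_Ioc_eq_integral μ hU hc hlim hab hI,
      ofReal_measureReal]
    filter_upwards [ae_restrict_mem measurableSet_Ioc] with x hx
    exact div_nonneg (h0 x (hI (Ioc_subset_Icc_self hx))) Real.pi_pos.le
  set A : Set (ℚ × ℚ) := {q | Icc (q.1 : ℝ) q.2 ⊆ U} with hA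
  have hcover : U = ⋃ q : A, Ioc (q.1.1 : ℝ) q.1.2 := by
    apply Subset.antisymm
    · intro x hx
      obtain ⟨δ, hδ, hball⟩ := Metric.isOpen_iff.1 hU x hx
      rw [Real.ball_eq_Ioo] at hball
      obtain ⟨p, hp1, hp2⟩ := exists_rat_btwn (show x - δ < x by linarith)
      obtain ⟨q, hq1, hq2⟩ := exists_rat_btwn (show x < x + δ by linarith)
      refine mem_iUnion.2 ⟨⟨(p, q), fun y hy => hball ⟨?_, ?_⟩⟩, hp2, hq1.le⟩
      · exact hp1.trans_le hy.1
      · exact hy.2.trans_lt hq2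
    · exact iUnion_subset fun q => Ioc_subset_Icc_self.trans q.2
  rw [hcover, Measure.restrict_iUnion_congr]
  rintro ⟨q, hq⟩
  refine Measure.ext_of_Ioc _ _ fun a b hab => ?_
  rw [Measure.restrict_apply measurableSet_Ioc, Measure.restrict_apply measurableSet_Ioc,
    Ioc_inter_Ioc]
  rcases lt_or_ge (a ⊔ (q.1 : ℝ)) (b ⊓ (q.2 : ℝ)) with hlt | hge
  · exact hIoc _ _ hlt ((Icc_subset_Icc le_sup_right inf_le_right).trans hq)
  · rw [Ioc_eq_empty_of_le hge]; simp

/-! ### Analyticity where the imaginary part is positive -/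

/-- The imaginary part gives `|E| ≥ κ (s + t)`, and the triangle inequality `|E| ≥ 1 - B (s + t)`; a
weighted sum bounds `|E|` below by a constant as well. A perturbation of size `ρ / 4` loses at most
half of the bound. -/
theorem exists_den_lower_bound {m₀ g₀ : ℂ} (hm : 0 < m₀.im) (hg : 0 < g₀.im) :
    ∃ δ η : ℝ, 0 < δ ∧ 0 < η ∧ ∀ q ∈ Metric.ball (m₀, g₀) η, ∀ p : ℝ × ℝ, 0 ≤ p.1 → 0 ≤ p.2 →
      δ * (1 + p.1 + p.2) ≤ ‖den q.1 q.2 p‖ := by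
  set κ := min m₀.im g₀.im with hκ
  have hκ0 : 0 < κ := lt_min hm hg
  set B := max ‖m₀‖ ‖g₀‖ with hB
  have hB0 : 0 ≤ B := (norm_nonneg _).trans (le_max_left _ _)
  set ρ := min (κ / (B + κ)) κ with hρ
  have hρ0 : 0 < ρ := by positivity
  have h0 : ∀ p : ℝ × ℝ, 0 ≤ p.1 → 0 ≤ p.2 → ρ * (1 + p.1 + p.2) ≤ 2 * ‖den m₀ g₀ p‖ := by
    intro p h1 h2
    have e1 : κ * (p.1 + p.2) ≤ ‖den m₀ g₀ p‖ := by
      have := (le_abs_self _).trans (Complex.abs_im_le_norm (den m₀ g₀ p))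
      rw [den_im] at this
      have a1 : p.1 * κ ≤ p.1 * g₀.im := by gcongr; exact min_le_right _ _
      have a2 : p.2 * κ ≤ p.2 * m₀.im := by gcongr; exact min_le_left _ _
      linarith
    have e2 : 1 - B * (p.1 + p.2) ≤ ‖den m₀ g₀ p‖ := by
      have a1 : (1 : ℂ) = den m₀ g₀ p - (p.1 * g₀ + p.2 * m₀) := by rw [den]; ring
      have a2 : ‖(p.1 * g₀ + p.2 * m₀ : ℂ)‖ ≤ p.1 * B + p.2 * B := by
        refine (norm_add_le _ _).trans ?_
        rw [norm_mul, norm_mul, Complex.norm_real, Complex.norm_real, Real.norm_of_nonneg h1,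
          Real.norm_of_nonneg h2]
        gcongr
        · exact le_max_right _ _
        · exact le_max_left _ _
      have a3 : (1 : ℝ) ≤ ‖den m₀ g₀ p‖ + ‖(p.1 * g₀ + p.2 * m₀ : ℂ)‖ := by
        calc (1 : ℝ) = ‖(1 : ℂ)‖ := by simp
          _ = ‖den m₀ g₀ p - (p.1 * g₀ + p.2 * m₀)‖ := by rw [← a1]
          _ ≤ _ := norm_sub_le _ _
      linarith
    have e3 : κ / (B + κ) ≤ ‖den m₀ g₀ p‖ := by
      rw [div_le_iff₀ (by positivity)]
      nlinarith [mul_le_mul_of_nonneg_left e1 hB0, mul_le_mul_of_nonneg_left e2 hκ0.le]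
    have e4 : ρ * 1 ≤ κ / (B + κ) := by rw [mul_one]; exact min_le_left _ _
    have e5 : ρ * (p.1 + p.2) ≤ κ * (p.1 + p.2) := by gcongr; exact min_le_right _ _
    linarith
  refine ⟨ρ / 4, ρ / 4, by positivity, by positivity, fun q hq p h1 h2 => ?_⟩
  rw [Metric.mem_ball, Prod.dist_eq, max_lt_iff, dist_eq_norm, dist_eq_norm] at hq
  have e1 : den m₀ g₀ p = den q.1 q.2 p - (p.1 * (q.2 - g₀) + p.2 * (q.1 - m₀)) := by
    simp only [den]; ring
  have e2 : ‖(p.1 * (q.2 - g₀) + p.2 * (q.1 - m₀) : ℂ)‖ ≤ p.1 * (ρ / 4) + p.2 * (ρ / 4) := by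
    refine (norm_add_le _ _).trans ?_
    rw [norm_mul, norm_mul, Complex.norm_real, Complex.norm_real, Real.norm_of_nonneg h1,
      Real.norm_of_nonneg h2]
    gcongr
    · exact hq.2.le
    · exact hq.1.le
  have e3 : ‖den m₀ g₀ p‖ ≤ ‖den q.1 q.2 p‖ + ‖(p.1 * (q.2 - g₀) + p.2 * (q.1 - m₀) : ℂ)‖ := by
    rw [e1]; exact norm_sub_le _ _
  have := h0 p h1 h2
  linarith

/-- The linear part `(m, g) ↦ s g + t m` of the denominator. -/
noncomputable def denLin (p : ℝ × ℝ) : ℂ × ℂ →L[ℂ] ℂ :=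
  (p.1 : ℂ) • ContinuousLinearMap.snd ℂ ℂ ℂ + (p.2 : ℂ) • ContinuousLinearMap.fst ℂ ℂ ℂ

theorem norm_denLin_le {p : ℝ × ℝ} (h1 : 0 ≤ p.1) (h2 : 0 ≤ p.2) : ‖denLin p‖ ≤ p.1 + p.2 := by
  refine (norm_add_le _ _).trans ?_
  rw [norm_smul, norm_smul, Complex.norm_real, Complex.norm_real, Real.norm_of_nonneg h1,
    Real.norm_of_nonneg h2]
  have a1 := ContinuousLinearMap.norm_snd_le ℂ ℂ ℂ
  have a2 := ContinuousLinearMap.norm_fst_le ℂ ℂ ℂ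
  nlinarith

theorem hasFDerivAt_den (p : ℝ × ℝ) (q : ℂ × ℂ) :
    HasFDerivAt (fun q : ℂ × ℂ => den q.1 q.2 p) (denLin p) q := by
  have : (fun q : ℂ × ℂ => den q.1 q.2 p) = fun q => 1 + denLin p q := by
    funext q
    simp [den, denLin]; ring
  rw [this]
  exact (denLin p).hasFDerivAt.const_add 1

/-- With `|E| ≥ δ (1 + s + t)`, the derivative of `k / E` in `(m, g)` is bounded by the constant `1
/ δ²`, uniformly near the point. Differentiation under the integral needs no further moments of `H`.
-/
theorem contDiffAt_integral_div_den {H : Measure (ℝ × ℝ)} [IsFiniteMeasure H]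
    (hH : ∀ᵐ p ∂H, 0 ≤ p.1 ∧ 0 < p.2) {k : ℝ × ℝ → ℝ} (hkm : Measurable k)
    (hk : ∀ᵐ p ∂H, 0 ≤ k p ∧ k p ≤ 1 + p.1 + p.2) {m₀ g₀ : ℂ} (hm : 0 < m₀.im) (hg : 0 < g₀.im) :
    ContDiffAt ℂ 1 (fun q : ℂ × ℂ => ∫ p, (k p : ℂ) / den q.1 q.2 p ∂H) (m₀, g₀) ∧
    ∃ N : ℂ × ℂ →L[ℂ] ℂ,
      HasFDerivAt (fun q : ℂ × ℂ => ∫ p, (k p : ℂ) / den q.1 q.2 p ∂H) N (m₀, g₀) ∧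
      ∀ u w : ℂ,
        Integrable (fun p : ℝ × ℝ => k p * (p.1 * w + p.2 * u) / (den m₀ g₀ p * den m₀ g₀ p)) H ∧
        N (u, w) = -∫ p : ℝ × ℝ, k p * (p.1 * w + p.2 * u) / (den m₀ g₀ p * den m₀ g₀ p) ∂H := by
  obtain ⟨δ, η, hδ, hη, hlow⟩ := exists_den_lower_bound hm hg
  set V := Metric.ball (m₀, g₀) η with hV
  have hVo : IsOpen V := Metric.isOpen_ball
  have hV0 : (m₀, g₀) ∈ V := Metric.mem_ball_self hη
  set f' : ℂ × ℂ → ℝ × ℝ → (ℂ × ℂ →L[ℂ] ℂ) := fun q p =>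
    (-((k p : ℂ) / (den q.1 q.2 p * den q.1 q.2 p))) • denLin p with hf'
  have hmeasF : ∀ q : ℂ × ℂ, AEStronglyMeasurable (fun p => (k p : ℂ) / den q.1 q.2 p) H := fun q =>
    ((Complex.measurable_ofReal.comp hkm).div (measurable_den _ _)).aestronglyMeasurable
  have hmeasF' : ∀ q, AEStronglyMeasurable (f' q) H := by
    intro q
    have h1 : Measurable fun p => -((k p : ℂ) / (den q.1 q.2 p * den q.1 q.2 p)) :=
      ((Complex.measurable_ofReal.comp hkm).div ((measurable_den _ _).mul (measurable_den _ _))).neg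
    have h2 : StronglyMeasurable denLin := by
      unfold denLin
      exact ((Complex.measurable_ofReal.comp measurable_fst).stronglyMeasurable.smul_const _).add
        ((Complex.measurable_ofReal.comp measurable_snd).stronglyMeasurable.smul_const _)
    exact h1.aestronglyMeasurable.smul h2.aestronglyMeasurable
  have hgood : ∀ᵐ p ∂H, 0 ≤ p.1 ∧ 0 ≤ p.2 ∧ 0 ≤ k p ∧ k p ≤ 1 + p.1 + p.2 := by
    filter_upwards [hH, hk] with p h1 h2
    exact ⟨h1.1, h1.2.le, h2.1, h2.2⟩
  have hne : ∀ q ∈ V, ∀ p : ℝ × ℝ, 0 ≤ p.1 → 0 ≤ p.2 → den q.1 q.2 p ≠ 0 := by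
    intro q hq p h1 h2
    refine norm_pos_iff.1 (lt_of_lt_of_le ?_ (hlow q hq p h1 h2))
    positivity
  have hFint : ∀ q ∈ V, Integrable (fun p => (k p : ℂ) / den q.1 q.2 p) H := by
    intro q hq
    refine Integrable.of_bound (hmeasF q) (1 / δ) ?_
    filter_upwards [hgood] with p hp
    obtain ⟨h1, h2, h3, h4⟩ := hp
    have h5 := hlow q hq p h1 h2
    have h6 : 0 < ‖den q.1 q.2 p‖ := norm_pos_iff.2 (hne q hq p h1 h2)
    rw [norm_div, Complex.norm_real, Real.norm_of_nonneg h3, div_le_div_iff₀ h6 hδ]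
    nlinarith
  have hbound : ∀ q ∈ V, ∀ᵐ p ∂H, ‖f' q p‖ ≤ 1 / δ ^ 2 := by
    intro q hq
    filter_upwards [hgood] with p hp
    obtain ⟨h1, h2, h3, h4⟩ := hp
    have h5 := hlow q hq p h1 h2
    have h6 : 0 < ‖den q.1 q.2 p‖ := norm_pos_iff.2 (hne q hq p h1 h2)
    rw [hf']
    simp only
    rw [norm_smul, norm_neg, norm_div, norm_mul, Complex.norm_real, Real.norm_of_nonneg h3,
      div_mul_eq_mul_div, div_le_div_iff₀ (by positivity) (by positivity)]
    have h7 : ‖denLin p‖ ≤ 1 + p.1 + p.2 := (norm_denLin_le h1 h2).trans (by linarith)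
    calc k p * ‖denLin p‖ * δ ^ 2 ≤ (1 + p.1 + p.2) * (1 + p.1 + p.2) * δ ^ 2 := by gcongr
      _ = (δ * (1 + p.1 + p.2)) * (δ * (1 + p.1 + p.2)) := by ring
      _ ≤ ‖den q.1 q.2 p‖ * ‖den q.1 q.2 p‖ := by gcongr
      _ = _ := by ring
  have hderiv : ∀ q ∈ V, HasFDerivAt (fun q : ℂ × ℂ => ∫ p, (k p : ℂ) / den q.1 q.2 p ∂H)
      (∫ p, f' q p ∂H) q := by
    intro q hq
    refine hasFDerivAt_integral_of_dominated_of_fderiv_le (bound := fun _ => 1 / δ ^ 2)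
      (hVo.mem_nhds hq) (Eventually.of_forall hmeasF) (hFint q hq) (hmeasF' q) ?_
      (integrable_const _) ?_
    · filter_upwards [hgood] with p hp
      obtain ⟨h1, h2, h3, h4⟩ := hp
      intro q hq
      have h5 := hlow q hq p h1 h2
      have h6 : 0 < ‖den q.1 q.2 p‖ := norm_pos_iff.2 (hne q hq p h1 h2)
      rw [hf']
      simp only
      rw [norm_smul, norm_neg, norm_div, norm_mul, Complex.norm_real, Real.norm_of_nonneg h3,
        div_mul_eq_mul_div, div_le_div_iff₀ (by positivity) (by positivity)]
      have h7 : ‖denLin p‖ ≤ 1 + p.1 + p.2 := (norm_denLin_le h1 h2).trans (by linarith)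
      calc k p * ‖denLin p‖ * δ ^ 2 ≤ (1 + p.1 + p.2) * (1 + p.1 + p.2) * δ ^ 2 := by gcongr
        _ = (δ * (1 + p.1 + p.2)) * (δ * (1 + p.1 + p.2)) := by ring
        _ ≤ ‖den q.1 q.2 p‖ * ‖den q.1 q.2 p‖ := by gcongr
        _ = _ := by ring
    · filter_upwards [hgood] with p hp
      obtain ⟨h1, h2, h3, h4⟩ := hp
      intro q hq
      have h5 := hne q hq p h1 h2
      have h6 := ((hasDerivAt_inv h5).comp_hasFDerivAt q (hasFDerivAt_den p q)).const_mul (k p : ℂ)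
      refine h6.congr_fderiv ?_
      simp only [hf', smul_smul]
      congr 1
      field_simp
  have hcont : ContinuousOn (fun q => ∫ p, f' q p ∂H) V := by
    refine continuousOn_of_dominated (bound := fun _ => 1 / δ ^ 2) (fun q _ => hmeasF' q) hbound
      (integrable_const _) ?_
    filter_upwards [hgood] with p hp
    obtain ⟨h1, h2, h3, h4⟩ := hp
    have h5 : Continuous fun q : ℂ × ℂ => den q.1 q.2 p := by unfold den; fun_prop
    exact ((continuousOn_const.div (h5.mul h5).continuousOn
      fun q hq => mul_ne_zero (hne q hq p h1 h2) (hne q hq p h1 h2)).neg).smul continuousOn_const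
  refine ⟨contDiffAt_one_iff.2 ⟨_, V, hVo.mem_nhds hV0, hcont, hderiv⟩, _, hderiv _ hV0,
    fun u w => ?_⟩
  have hi : Integrable (f' (m₀, g₀)) H :=
    Integrable.of_bound (hmeasF' _) _ (hbound _ hV0)
  have happ : ∀ p : ℝ × ℝ, f' (m₀, g₀) p (u, w)
      = -(k p * (p.1 * w + p.2 * u) / (den m₀ g₀ p * den m₀ g₀ p)) := by
    intro p
    show -((k p : ℂ) / (den m₀ g₀ p * den m₀ g₀ p)) * (p.1 * w + p.2 * u) = _
    ring
  constructor
  · have h1 := (hi.apply_continuousLinearMap (u, w)).neg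
    refine h1.congr (ae_of_all _ fun p => ?_)
    simp only [Pi.neg_apply, happ, neg_neg]
  · rw [ContinuousLinearMap.integral_apply hi, ← integral_neg]
    simp_rw [happ]

/-- If `g` were real, the imaginary part of the second equation would be a negative multiple of `Im
m ∫ t² / |E|²`, yet equal to `Im x = 0`. -/
theorem companion_aux_im_pos {c : ℝ} (hc : 0 < c) {H : Measure (ℝ × ℝ)} [IsProbabilityMeasure H]
    (hH : ∀ᵐ p ∂H, 0 ≤ p.1 ∧ 0 < p.2) {x : ℝ} {m g : ℂ} (h : SolvesCompanionSystem c H x m g)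
    (hm : 0 < m.im) (hg : 0 ≤ g.im) : 0 < g.im := by
  refine lt_of_le_of_ne hg fun h0 => ?_
  have hB : (x : ℂ) = -1 / g + c * ∫ p : ℝ × ℝ, (p.2 : ℂ) / den m g p ∂H := h.eq_snd
  have hi : Integrable (fun p : ℝ × ℝ => (p.2 : ℂ) / den m g p) H := h.integrable_snd
  have e1 := congrArg Complex.im hB
  have e2 : (-1 / g).im = 0 := by
    have := im_real_div (-1) g
    push_cast at this
    rw [this, ← h0]; simp
  rw [Complex.ofReal_im, Complex.add_im, e2, zero_add, Complex.im_ofReal_mul] at e1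
  have e3 := (mul_eq_zero.1 e1.symm).resolve_left hc.ne'
  have e4 : ∀ p : ℝ × ℝ, -((p.2 : ℂ) / den m g p).im = p.2 * (p.2 * m.im) / ‖den m g p‖ ^ 2 := by
    intro p
    rw [im_real_div, den_im, ← h0]; ring
  have hi' : Integrable (fun p : ℝ × ℝ => p.2 * (p.2 * m.im) / ‖den m g p‖ ^ 2) H := by
    simp_rw [← e4]
    exact hi.im.neg
  have e5 : ∫ p : ℝ × ℝ, p.2 * (p.2 * m.im) / ‖den m g p‖ ^ 2 ∂H = 0 := by
    simp_rw [← e4]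
    have := integral_im hi
    simp only [RCLike.im_eq_complex_im] at this
    rw [integral_neg, this, e3, neg_zero]
  have e6 := (integral_eq_zero_iff_of_nonneg_ae (hH.mono fun p hp => by
    have := hp.2
    simp only [Pi.zero_apply]
    positivity) hi').1 e5
  have e7 : ∀ᵐ p ∂H, False := by
    filter_upwards [e6, hH, h.denom_ne] with p h1 h2 h3
    have h4 : 0 < ‖den m g p‖ := norm_pos_iff.2 h3
    have h5 := h2.2
    have : 0 < p.2 * (p.2 * m.im) / ‖den m g p‖ ^ 2 := by positivity
    exact this.ne' h1
  simpa using e7.exists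

/-- Near a solution in the upper half plane, the companion system has an analytic solution curve. -/
theorem analyticAt_companion {c : ℝ} (hc : 0 < c) {H : Measure (ℝ × ℝ)}
    [IsProbabilityMeasure H] (hH : ∀ᵐ p ∂H, 0 ≤ p.1 ∧ 0 < p.2) {x : ℝ} (hx : 0 < x)
    {mu gu : ℝ → ℂ} (hmu : ContinuousAt mu x) (hgu : ContinuousAt gu x)
    (hS : ∀ᶠ y in 𝓝 x, SolvesCompanionSystem c H (y : ℝ) (mu y) (gu y))
    (hst : IsStableSol c H ‖(x : ℂ)‖ (mu x) (gu x)) (hm : 0 < (mu x).im) (hg0 : 0 ≤ (gu x).im) :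
    AnalyticAt ℝ (fun y => (mu y).im / Real.pi) x := by
  have hSx := hS.self_of_nhds
  have hg : 0 < (gu x).im := companion_aux_im_pos hc hH hSx hm hg0
  have hgne : gu x ≠ 0 := hSx.aux_ne
  set m₀ := mu x with hm₀
  set g₀ := gu x with hg₀
  obtain ⟨c1, N1, d1, n1⟩ := contDiffAt_integral_div_den hH (k := fun _ => 1) measurable_const
    (hH.mono fun p hp => ⟨zero_le_one, by linarith [hp.1, hp.2]⟩) hm hg
  obtain ⟨c2, N2, d2, n2⟩ := contDiffAt_integral_div_den hH (k := fun p => p.2) measurable_snd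
    (hH.mono fun p hp => ⟨hp.2.le, by linarith [hp.1]⟩) hm hg
  simp only [Complex.ofReal_one] at c1 d1 n1
  set Z : ℂ × ℂ → ℂ := fun q => -q.2⁻¹ + c * ∫ p : ℝ × ℝ, (p.2 : ℂ) / den q.1 q.2 p ∂H with hZ
  -- `Z` solves the second equation for the spectral parameter. Both equations at `y` then become `Ψ
  -- (m, g) = (y, -(1 - c))`, an inverse function problem in which `y` enters only as a value.
  set Ψ : ℂ × ℂ → ℂ × ℂ := fun q =>
    (Z q, Z q * q.1 + c * ∫ p, 1 / den q.1 q.2 p ∂H) with hΨ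
  have hZc : ContDiffAt ℂ 1 Z (m₀, g₀) :=
    ((contDiffAt_snd.inv hgne).neg).add (contDiffAt_const.mul c2)
  have hΨc : ContDiffAt ℂ 1 Ψ (m₀, g₀) :=
    hZc.prodMk ((hZc.mul contDiffAt_fst).add (contDiffAt_const.mul c1))
  have hval : ∀ y : ℝ, SolvesCompanionSystem c H (y : ℝ) (mu y) (gu y) →
      Ψ (mu y, gu y) = ((y : ℂ), -(1 - (c : ℂ))) := by
    intro y hy
    have hB : (y : ℂ) = -1 / gu y + c * ∫ p : ℝ × ℝ, (p.2 : ℂ) / den (mu y) (gu y) p ∂H := hy.eq_snd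
    have hA : (y : ℂ) * mu y = -(1 - (c : ℂ)) - c * ∫ p, 1 / den (mu y) (gu y) p ∂H := hy.eq_fst
    have hZy : Z (mu y, gu y) = y := by
      simp only [hZ]
      rw [← one_div, ← neg_div]
      exact hB.symm
    refine Prod.ext hZy ?_
    show Z (mu y, gu y) * mu y + c * ∫ p, 1 / den (mu y) (gu y) p ∂H = _
    rw [hZy, hA]; ring
  -- the derivative of `Ψ`
  have hZd : HasFDerivAt Z ((g₀ ^ 2)⁻¹ • ContinuousLinearMap.snd ℂ ℂ ℂ + (c : ℂ) • N2) (m₀, g₀) := by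
    have h1 : HasFDerivAt (fun q : ℂ × ℂ => -q.2⁻¹) ((g₀ ^ 2)⁻¹ • ContinuousLinearMap.snd ℂ ℂ ℂ)
        (m₀, g₀) := by
      have := ((hasDerivAt_inv hgne).comp_hasFDerivAt (m₀, g₀)
        (hasFDerivAt_snd (𝕜 := ℂ) (E := ℂ) (F := ℂ) (p := (m₀, g₀)))).neg
      refine this.congr_fderiv ?_
      ext <;> simp
    exact h1.add (d2.const_mul (c : ℂ))
  have hΨd := hZd.prodMk ((hZd.mul (hasFDerivAt_fst (𝕜 := ℂ) (E := ℂ) (F := ℂ) (p := (m₀, g₀)))).add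
    (d1.const_mul (c : ℂ)))
  set L := ((g₀ ^ 2)⁻¹ • ContinuousLinearMap.snd ℂ ℂ ℂ + (c : ℂ) • N2).prod
    (Z (m₀, g₀) • ContinuousLinearMap.fst ℂ ℂ ℂ +
      (m₀, g₀).1 • ((g₀ ^ 2)⁻¹ • ContinuousLinearMap.snd ℂ ℂ ℂ + (c : ℂ) • N2) + (c : ℂ) • N1) with hL
  change HasFDerivAt Ψ L (m₀, g₀) at hΨd
  have hZx : Z (m₀, g₀) = x := congrArg Prod.fst (hval x hSx)
  -- A kernel vector satisfies the difference system with both solutions equal, so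
  -- `stable_pair_kernel` applies. Its exceptional case `E = conj E` is excluded by `Im E > 0`.
  have hinj : Function.Injective L := by
    rw [injective_iff_map_eq_zero]
    rintro ⟨u, w⟩ huw
    obtain ⟨i1, e1⟩ := n1 u w
    obtain ⟨i2, e2⟩ := n2 u w
    have hL1 : (g₀ ^ 2)⁻¹ * w + c * N2 (u, w) = 0 := by
      simpa [hL] using congrArg Prod.fst huw
    have hL2 : Z (m₀, g₀) * u + m₀ * ((g₀ ^ 2)⁻¹ * w + c * N2 (u, w)) + c * N1 (u, w) = 0 := by
      simpa [hL, mul_add] using congrArg Prod.snd huw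
    rw [hL1, mul_zero, add_zero, hZx, e1] at hL2
    rw [e2] at hL1
    simp only [one_mul] at i1 hL2
    obtain ⟨k1, k2⟩ := stable_pair_kernel hc hH hSx.denom_ne hSx.denom_ne hst hst i1
      (by linear_combination hL2) i2 (by
        rw [div_eq_mul_inv, ← pow_two]
        linear_combination hL1)
    by_cases hu : u = 0
    · rw [hu, k1 hu]; rfl
    · have h1 := k2 hx hu
      have h2 : ∀ᵐ p ∂H, False := by
        filter_upwards [h1, hH] with p h1 h2
        have h3 := congrArg Complex.im h1
        rw [Complex.conj_im, den_im] at h3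
        have a1 := mul_nonneg h2.1 hg.le
        have a2 := mul_pos h2.2 hm
        linarith
      exact absurd h2.exists (by simp)
  set L' : (ℂ × ℂ) ≃L[ℂ] (ℂ × ℂ) :=
    (LinearEquiv.ofInjectiveEndo (L : ℂ × ℂ →ₗ[ℂ] ℂ × ℂ) hinj).toContinuousLinearEquiv with hL'
  have hLL' : (L' : ℂ × ℂ →L[ℂ] ℂ × ℂ) = L := by
    ext <;> rfl
  rw [← hLL'] at hΨd
  set inv := hΨc.localInverse hΨd one_ne_zero with hinv
  have hinvc : ContDiffAt ℂ 1 inv (Ψ (m₀, g₀)) := hΨc.to_localInverse hΨd one_ne_zero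
  rw [hval x hSx] at hinvc
  set φ : ℂ → ℂ := fun z => (inv (z, -(1 - (c : ℂ)))).1 with hφ
  have hφc : ContDiffAt ℂ 1 φ (x : ℂ) :=
    contDiffAt_fst.comp (x : ℂ) (ContDiffAt.comp (x : ℂ) hinvc
      (contDiffAt_id.prodMk contDiffAt_const))
  have hφa : AnalyticAt ℂ φ (x : ℂ) := by
    rw [Complex.analyticAt_iff_eventually_differentiableAt]
    filter_upwards [hφc.eventually (by simp)] with z hz
    exact hz.differentiableAt one_ne_zero
  have hφr : AnalyticAt ℝ (fun y : ℝ => (φ y).im / Real.pi) x := by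
    have h1 : AnalyticAt ℝ (fun y : ℝ => φ y) x :=
      (hφa.restrictScalars (𝕜 := ℝ)).comp (Complex.ofRealCLM.analyticAt x)
    exact ((Complex.imCLM.analyticAt _).comp h1).div analyticAt_const Real.pi_ne_zero
  refine hφr.congr ?_
  -- Continuity keeps the boundary values near `(m₀, g₀)`, where the local inverse recovers them
  -- from `Ψ`; hence they lie on the analytic branch.
  have hleft : ∀ᶠ q in 𝓝 (m₀, g₀), inv (Ψ q) = q :=
    (hΨc.hasStrictFDerivAt' hΨd one_ne_zero).eventually_left_inverse
  have hpair : Tendsto (fun y => (mu y, gu y)) (𝓝 x) (𝓝 (m₀, g₀)) := hmu.prodMk_nhds hgu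
  filter_upwards [hpair.eventually hleft, hS] with y h1 h2
  rw [hval y h2] at h1
  simp only [hφ, h1]

/-! ### Assembly of the theorem -/

/-- In `ENNReal` the inverse of `0` is `⊤`, so finiteness of the inverse moment excludes mass on `t
≤ 0`. -/
theorem ae_snd_pos {H : Measure (ℝ × ℝ)} (hHinv : ∫⁻ p : ℝ × ℝ, (ENNReal.ofReal p.2)⁻¹ ∂H < ⊤) :
    ∀ᵐ p ∂H, 0 < p.2 := by
  have hm : Measurable fun p : ℝ × ℝ => (ENNReal.ofReal p.2)⁻¹ :=
    (ENNReal.measurable_ofReal.comp measurable_snd).inv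
  filter_upwards [ae_lt_top hm hHinv.ne] with p hp
  exact ENNReal.ofReal_pos.1 (ENNReal.inv_lt_top.1 hp)

/-- The atom at `0` adds a locally constant term to the distribution function away from `0`. -/
theorem hasDerivAt_measureReal_of_companionLSD {c : ℝ} (hc0 : 0 < c) (hc1 : c ≤ 1) {F : Measure ℝ}
    [IsProbabilityMeasure F] {x d : ℝ} (hx : x ≠ 0)
    (h : HasDerivAt (fun y : ℝ => (companionLSD c F).real (Iic y)) d x) :
    HasDerivAt (fun y : ℝ => F.real (Iic y)) (d / c) x := by
  have key : ∀ y, (companionLSD c F).real (Iic y)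
      = (1 - c) * (Measure.dirac (0 : ℝ)).real (Iic y) + c * F.real (Iic y) := by
    intro y
    simp only [companionLSD]
    rw [measureReal_add_apply (ENNReal.mul_ne_top ENNReal.ofReal_ne_top (measure_ne_top _ _))
        (ENNReal.mul_ne_top ENNReal.ofReal_ne_top (measure_ne_top _ _)),
      measureReal_ennreal_smul_apply, measureReal_ennreal_smul_apply,
      ENNReal.toReal_ofReal (by linarith), ENNReal.toReal_ofReal hc0.le]
  have hconst : ∀ᶠ y in 𝓝 x, (Measure.dirac (0 : ℝ)).real (Iic y)
      = (Measure.dirac (0 : ℝ)).real (Iic x) := by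
    rcases lt_or_gt_of_ne hx with h0 | h0
    · filter_upwards [eventually_lt_nhds h0] with y hy
      simp [measureReal_def, h0.not_ge, hy.not_ge]
    · filter_upwards [eventually_gt_nhds h0] with y hy
      simp [measureReal_def, h0.le, hy.le]
  refine ((h.sub_const ((1 - c) * (Measure.dirac (0 : ℝ)).real (Iic x))).div_const c
    ).congr_of_eventuallyEq ?_
  filter_upwards [hconst] with y hy
  rw [key, hy]
  field_simp
  ring

theorem mainTheorem2 (c : ℝ) (hc0 : 0 < c) (hc1 : c ≤ 1)
    (H : Measure (ℝ × ℝ)) [IsProbabilityMeasure H]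
    (hH : ∀ᵐ p ∂H, 0 ≤ p.1 ∧ 0 ≤ p.2)
    (hH1 : ∫⁻ p : ℝ × ℝ, ENNReal.ofReal p.2 ∂H < ⊤)
    (hHinv : ∫⁻ p : ℝ × ℝ, (ENNReal.ofReal p.2)⁻¹ ∂H < ⊤)
    (F : Measure ℝ) (g : ℂ → ℂ) (hF : IsLSD c H F g) :
    ∃ mu gu : ℝ → ℂ,
      (∀ x : ℝ, x ≠ 0 →
        Tendsto (stieltjes (companionLSD c F)) (𝓝[upperHalf] (x : ℂ)) (𝓝 (mu x)) ∧
        Tendsto (companionAux c g) (𝓝[upperHalf] (x : ℂ)) (𝓝 (gu x)) ∧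
        SolvesCompanionSystem c H (x : ℂ) (mu x) (gu x)) ∧
      ContinuousOn mu {0}ᶜ ∧
      (∀ x : ℝ, x ≠ 0 →
        HasDerivAt (fun y : ℝ => (companionLSD c F).real (Iic y)) ((mu x).im / Real.pi) x ∧
        HasDerivAt (fun y : ℝ => F.real (Iic y)) ((mu x).im / (c * Real.pi)) x) ∧
      (companionLSD c F).restrict {0}ᶜ =
        (volume.restrict {0}ᶜ).withDensity
          (fun x : ℝ => ENNReal.ofReal ((mu x).im / Real.pi)) ∧
      (∀ x : ℝ, x ≠ 0 → 0 < (mu x).im →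
        AnalyticAt ℝ (fun y : ℝ => (mu y).im / Real.pi) x) := by
  have hpos : ∀ᵐ p ∂H, 0 ≤ p.1 ∧ 0 < p.2 := by
    filter_upwards [hH, ae_snd_pos hHinv] with p h1 h2
    exact ⟨h1.1, h2⟩
  have ht : Integrable (fun p : ℝ × ℝ => p.2) H := by
    refine ⟨measurable_snd.aestronglyMeasurable, ?_⟩
    rwa [hasFiniteIntegral_iff_ofReal (hpos.mono fun p hp => hp.2.le)]
  have hti : Integrable (fun p : ℝ × ℝ => p.2⁻¹) H := by
    refine ⟨measurable_snd.inv.aestronglyMeasurable, ?_⟩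
    rw [hasFiniteIntegral_iff_ofReal (hpos.mono fun p hp => inv_nonneg.2 hp.2.le)]
    refine lt_of_eq_of_lt (lintegral_congr_ae (hpos.mono fun p hp => ?_)) hHinv
    exact ENNReal.ofReal_inv_of_pos hp.2
  have := hF.isProbabilityMeasure
  have := isProbabilityMeasure_companionLSD (F := F) hc0 hc1
  set M := stieltjes (companionLSD c F) with hM
  set G := companionAux c g with hG
  have hlim := fun {x : ℝ} (hx : x ≠ 0) => hF.exists_boundary_limit hc0 hc1 hpos ht hti hx
  rw [← hM, ← hG] at hlim
  -- Taking boundary values by `extendFrom` yields continuity at once: it needs only a limit at each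
  -- boundary point along the whole half plane.
  set mu : ℝ → ℂ := fun x => extendFrom upperHalf M x with hmu
  set gu : ℝ → ℂ := fun x => extendFrom upperHalf G x with hgu
  have hlim' : ∀ x : ℝ, x ≠ 0 → Tendsto M (𝓝[upperHalf] (x : ℂ)) (𝓝 (mu x)) ∧
      Tendsto G (𝓝[upperHalf] (x : ℂ)) (𝓝 (gu x)) ∧ SolvesCompanionSystem c H x (mu x) (gu x) ∧
      IsStableSol c H ‖(x : ℂ)‖ (mu x) (gu x) ∧ 0 ≤ (mu x).im ∧ 0 ≤ (gu x).im := by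
    intro x hx
    obtain ⟨m₀, g₀, h1, h2, h3⟩ := hlim hx
    have e1 : mu x = m₀ := extendFrom_eq (mem_closure_upperHalf x) h1
    have e2 : gu x = g₀ := extendFrom_eq (mem_closure_upperHalf x) h2
    rw [e1, e2]
    exact ⟨h1, h2, h3⟩
  have hcont : ∀ φ : ℂ → ℂ, (∀ x : ℝ, x ≠ 0 → ∃ y, Tendsto φ (𝓝[upperHalf] (x : ℂ)) (𝓝 y)) →
      ContinuousOn (fun x : ℝ => extendFrom upperHalf φ x) {0}ᶜ := by
    intro φ hφ
    have h1 : ContinuousOn (extendFrom upperHalf φ) ((fun x : ℝ => (x : ℂ)) '' {0}ᶜ) := by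
      refine continuousOn_extendFrom ?_ ?_
      · rintro _ ⟨x, -, rfl⟩
        exact mem_closure_upperHalf x
      · rintro _ ⟨x, hx, rfl⟩
        exact hφ x hx
    exact h1.comp Complex.continuous_ofReal.continuousOn (mapsTo_image _ _)
  have hmuc : ContinuousOn mu {0}ᶜ := hcont M fun x hx => ⟨_, (hlim' x hx).1⟩
  have hguc : ContinuousOn gu {0}ᶜ := hcont G fun x hx => ⟨_, (hlim' x hx).2.1⟩
  have hU : IsOpen ({0}ᶜ : Set ℝ) := isOpen_compl_singleton
  have himc : ContinuousOn (fun x => (mu x).im) {0}ᶜ :=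
    Complex.continuous_im.comp_continuousOn hmuc
  have himlim : ∀ x ∈ ({0}ᶜ : Set ℝ),
      Tendsto (fun z => (M z).im) (𝓝[upperHalf] (x : ℂ)) (𝓝 (mu x).im) := fun x hx =>
    (Complex.continuous_im.tendsto _).comp (hlim' x hx).1
  refine ⟨mu, gu, fun x hx => ⟨(hlim' x hx).1, (hlim' x hx).2.1, (hlim' x hx).2.2.1⟩, hmuc,
    fun x hx => ?_, ?_, fun x hx hpos_im => ?_⟩
  · have h1 := hasDerivAt_measureReal_Iic (companionLSD c F) hU himc himlim hx
    refine ⟨h1, ?_⟩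
    have h2 := hasDerivAt_measureReal_of_companionLSD hc0 hc1 hx h1
    rwa [div_div, mul_comm Real.pi c] at h2
  · exact restrict_eq_withDensity_of_stieltjes (companionLSD c F) hU himc
      (fun x hx => (hlim' x hx).2.2.2.2.1) himlim
  · have hx0 : 0 < x := by
      by_contra hcon
      have hneg : x < 0 := lt_of_le_of_ne (not_lt.1 hcon) hx
      have := mem_closure_iff_nhdsWithin_neBot.1 (mem_closure_upperHalf x)
      have h1 : Tendsto (fun z : ℂ => (z * M z).im) (𝓝[upperHalf] (x : ℂ)) (𝓝 ((x * mu x).im)) :=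
        (Complex.continuous_im.tendsto _).comp
          ((tendsto_id.mono_left nhdsWithin_le_nhds).mul (hlim' x hx).1)
      have h2 : 0 ≤ (x * mu x).im := by
        refine ge_of_tendsto h1 ?_
        filter_upwards [self_mem_nhdsWithin] with z hz
        exact mul_stieltjes_im_nonneg _ (companionLSD_Iio hF.nonneg) hz
      rw [Complex.im_ofReal_mul] at h2
      have := mul_neg_of_neg_of_pos hneg hpos_im
      linarith
    refine analyticAt_companion hc0 hpos hx0 (hmuc.continuousAt (hU.mem_nhds hx))
      (hguc.continuousAt (hU.mem_nhds hx)) ?_ (hlim' x hx).2.2.2.1 hpos_im (hlim' x hx).2.2.2.2.2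
    filter_upwards [isOpen_ne.mem_nhds hx] with y hy
    exact (hlim' y hy).2.2.1
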